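/- Let $\Lambda$ be a finite set of sites (no lattice structure, hence no dimension, is needed) and let $k\ge 3$ be an integer. On the bosonic Fock space over $\Lambda$, with annihilation and creation operators $b_i,b_i^\dagger$ and $\hat n_i=b_i^\dagger b_i$, consider $$H=H_0(\vec b,\vec b^\dagger)+V_+(\vec n)+\sum_{i\in\Lambda}U_i\,\hat n_i^{k/2},\qquad U_i>0,$$ where $$H_0=\sum_{k_1=1}^{k}\ \sum_{i_1,\dots,i_{k_1}\in\Lambda}\ \sum_{s=1}^{k_1+1}J^{(s)}_{i_1,\dots,i_{k_1}}\,b^\dagger_{i_{k_1}}\cdots b^\dagger_{i_s}b_{i_{s-1}}\cdots b_{i_1}$$ is Hermitian and $V_+=\sum_{k_1=1}^{\lfloor k/2\rfloor}\sum_{i_1,\dots,i_{k_1}}V_{i_1,\dots,i_{k_1}}\hat n_{i_1}\cdots\hat n_{i_{k_1}}$ with all $V_{i_1,\dots,i_{k_1}}\ge 0$. Put $$\bar J_{i,k_1}=\sum_{\substack{i_1,\dots,i_{k_1}\in\Lambda\\ \{i_1,\dots,i_{k_1}\}\ni i}}\ \sum_{s=1}^{k_1+1}\bigl|J^{(s)}_{i_1,\dots,i_{k_1}}\bigr|,\qquad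 \bar{\mathcal J}=\max_{i\in\Lambda}\sum_{k_1=1}^{k}\bar J_{i,k_1}\bigl[1+(2k_1)^{k_1}\bigr],$$ and assume the repulsive condition $U_i>5\bar J_{i,k}$ for all $i\in\Lambda$. States are normalized vectors $\psi$ with $\langle\psi|\hat n_i^{k/2}|\psi\rangle<\infty$ for all $i$; they range over the whole Fock space or, if $H$ conserves the total boson number, over the sector with a fixed total boson number $N$. Let $|\Omega\rangle$ be a ground state, i.e. a state that minimizes $\langle\psi|H|\psi\rangle$ among these states, and let $E_0=\langle\Omega|H|\Omega\rangle$. For $Q>0$ let $\mathcal E_Q$ be the infimum of $\langle\psi|H|\psi\rangle$ over those states with $\max_{j\in\Lambda}\langle\psi|\hat n_j^{k/2}|\psi\rangle=Q^{k/2}$ (with $\mathcal E_Q=+\infty$ if there are none). Theorem. Let $i\in\Lambda$ with $\bar J_{i,k}>0$, and let $\check{\mathcal J}\in\mathbb R$ be such that $$\mathcal E_Q-E_0\ \ge\ (U_i-\bar J_{i,k})\,Q^{k/2}-\check{\mathcal J}\,Q^{(k-1)/2}\qquad\text{for all }Q>0 .$$ Let $0<\mathfrak u_i<U_i-5\bar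 J_{i,k}$ and $$\zeta=\frac{\bar J_{i,k}}{U_i-\mathfrak u_i-\bar J_{i,k}},\qquad M_{i,0}=\max\left[2^{2/k}\left(\frac{\check{\mathcal J}}{U_i-\bar J_{i,k}}\right)^{2},\ \left(\frac{\check{\mathcal J}\,\bar J_{i,k}+2\bar{\mathcal J}\,(U_i-\mathfrak u_i-\bar J_{i,k})}{\mathfrak u_i\,\bar J_{i,k}}\right)^{2}\right].$$ Then $0<\frac{1-\sqrt{1-16\zeta^2}}{4\zeta}<1$, and for every real $x$ $$\langle\Omega|\Pi_{i,\ge x}|\Omega\rangle\ \le\ \left(\frac{1-\sqrt{1-16\zeta^2}}{4\zeta}\right)^{2(x-M_{i,0})/k},$$ where $\Pi_{i,\ge x}$ is the projection onto the states with at least $x$ bosons at the site $i$. No spectral gap and no non-degeneracy of the ground state is assumed. -/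

import Mathlib

open scoped ComplexConjugate

noncomputable section

namespace Boson

/-- Occupation numbers: the labels of the Mott states on the set of sites `Λ`. -/
abbrev Config (Λ : Type*) := Λ → ℕ

/-- The bosonic Fock space on `Λ`, written in the orthonormal basis of Mott states. -/
abbrev FockSpace (Λ : Type*) := lp (fun _ : Config Λ => ℂ) 2

/-- Operators, acting on arbitrary families of amplitudes. Unbounded operators such as `b_i` are
thereby defined without a domain; the domain appears when expectation values are taken. -/
abbrev Op (Λ : Type*) := Module.End ℂ (Config Λ → ℂ)

section Operators

variable {Λ : Type*}

/-- The operator that is diagonal in the Mott basis with eigenvalues `f n`. -/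
def diagonal (f : Config Λ → ℝ) : Op Λ where
  toFun ψ n := (f n : ℂ) * ψ n
  map_add' ψ φ := by funext n; simp [mul_add]
  map_smul' c ψ := by funext n; simp; ring

/-- The annihilation operator `b_i`, with `b_i |n⟩ = √n_i |n - e_i⟩`. -/
def annihilate [DecidableEq Λ] (i : Λ) : Op Λ where
  toFun ψ n := (Real.sqrt ((n i : ℝ) + 1) : ℂ) * ψ (n + Pi.single i 1)
  map_add' ψ φ := by funext n; simp [mul_add]
  map_smul' c ψ := by funext n; simp; ring

/-- The creation operator `b_i†`, with `b_i† |n⟩ = √(n_i + 1) |n + e_i⟩`. (At `n i = 0` the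
amplitude is multiplied by `0`, so the truncated subtraction is harmless.) -/
def create [DecidableEq Λ] (i : Λ) : Op Λ where
  toFun ψ n := (Real.sqrt (n i : ℝ) : ℂ) * ψ (n - Pi.single i 1)
  map_add' ψ φ := by funext n; simp [mul_add]
  map_smul' c ψ := by funext n; simp; ring

/-- The number operator `n_i = b_i† b_i`. -/
def number [DecidableEq Λ] (i : Λ) : Op Λ := create i * annihilate i

/-- The number operator is diagonal in the Mott basis, with eigenvalue `n i`. -/
theorem number_eq_diagonal [DecidableEq Λ] (i : Λ) :
    number i = diagonal (fun n : Config Λ => (n i : ℝ)) := by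
  refine LinearMap.ext fun ψ => funext fun n => ?_
  rcases Nat.eq_zero_or_pos (n i) with h | h
  · simp [number, create, diagonal, h]
  · have h1 : n - Pi.single i 1 + Pi.single i 1 = n := by
      funext j
      by_cases hj : j = i
      · subst hj; simp; omega
      · simp [hj]
    have h2 : ((n i - 1 : ℕ) : ℝ) + 1 = (n i : ℝ) := by
      rw [Nat.cast_sub h]; simp
    have h3 : (Real.sqrt (n i : ℝ) : ℂ) * (Real.sqrt (n i : ℝ) : ℂ) = ((n i : ℝ) : ℂ) := by
      rw [← Complex.ofReal_mul, Real.mul_self_sqrt (Nat.cast_nonneg _)]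
    simp only [number, Module.End.mul_apply, create, annihilate, diagonal, LinearMap.coe_mk,
      AddHom.coe_mk, Pi.sub_apply, Pi.single_eq_same, h1, h2]
    rw [← mul_assoc, h3]

/-- The real power `n_i ^ r` of the number operator. -/
def numberPow (i : Λ) (r : ℝ) : Op Λ := diagonal fun n => (n i : ℝ) ^ r

/-- The total number operator `∑ i, n_i`. -/
def totalNumber (Λ : Type*) [Fintype Λ] [DecidableEq Λ] : Op Λ := ∑ i, number i

open Classical in
/-- The projection `Π_{i, ≥ x}` onto at least `x` bosons at the site `i`. -/
def projGE (i : Λ) (x : ℝ) : Op Λ := diagonal fun n => if x ≤ (n i : ℝ) then 1 else 0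

/-- The expectation value `⟨ψ| A |ψ⟩`. -/
def expect (A : Op Λ) (ψ : FockSpace Λ) : ℂ := ∑' n, conj (ψ n) * A ψ n

open Classical in
/-- The matrix element `⟨n| A |m⟩` between Mott states. -/
def matrixElement (A : Op Λ) (n m : Config Λ) : ℂ := A (Pi.single m 1) n

/-- The ordered monomial `b†_{i_{k₁}} ⋯ b†_{i_{s+1}} b_{i_s} ⋯ b_{i_1}`: the first `s` sites of the
tuple carry annihilation operators (`0 ≤ s ≤ k₁`), the others creation operators. -/
def monomial [DecidableEq Λ] {k₁ : ℕ} (s : Fin (k₁ + 1)) (t : Fin k₁ → Λ) : Op Λ :=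
  (List.ofFn fun j : Fin k₁ =>
    if (j : ℕ) < (s : ℕ) then annihilate (t j) else create (t j)).reverse.prod

/-- The subspace of Fock space with total boson number equal to `N`. -/
def numberSector (Λ : Type*) [Fintype Λ] [DecidableEq Λ] (N : ℕ) : Set (FockSpace Λ) :=
  {ψ | totalNumber Λ ψ = (N : ℂ) • (ψ : Config Λ → ℂ)}

end Operators

/-- The polynomial `H_0(b, b†) = ∑_{k₁=1}^{k} ∑_{i_1,…,i_{k₁}} ∑_s J^{(s)}_{i_1,…,i_{k₁}}
b†_{i_{k₁}} ⋯ b_{i_1}`. -/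
def hopping {Λ : Type*} [Fintype Λ] [DecidableEq Λ] (k : ℕ)
    (J : (k₁ : ℕ) → Fin (k₁ + 1) → (Fin k₁ → Λ) → ℂ) : Op Λ :=
  ∑ k₁ ∈ Finset.Icc 1 k, ∑ t : Fin k₁ → Λ, ∑ s : Fin (k₁ + 1), J k₁ s t • monomial s t

/-- The data of a Hamiltonian `H = H_0(b, b†) + V_+(n) + ∑ i, U_i n_i^{k/2}` of the
Bose–Hubbard class of degree `k`. -/
structure BoseHubbard (Λ : Type*) [Fintype Λ] [DecidableEq Λ] (k : ℕ) where
  /-- The coefficients of `H_0`; `J k₁ s t` multiplies `monomial s t`. -/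
  J : (k₁ : ℕ) → Fin (k₁ + 1) → (Fin k₁ → Λ) → ℂ
  /-- The coefficients of `V_+`. -/
  V : (k₁ : ℕ) → (Fin k₁ → Λ) → ℝ
  /-- The on-site repulsion. -/
  U : Λ → ℝ
  hermitian : ∀ n m, matrixElement (hopping k J) n m = conj (matrixElement (hopping k J) m n)
  V_nonneg : ∀ k₁ t, 0 ≤ V k₁ t
  U_pos : ∀ i, 0 < U i

namespace BoseHubbard

variable {Λ : Type*} [Fintype Λ] [DecidableEq Λ] {k : ℕ} (H : BoseHubbard Λ k)

/-- `V_+(n) = ∑_{k₁=1}^{⌊k/2⌋} ∑_{i_1,…,i_{k₁}} V_{i_1,…,i_{k₁}} n_{i_1} ⋯ n_{i_{k₁}}`. -/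
def potential : Op Λ :=
  ∑ k₁ ∈ Finset.Icc 1 (k / 2), ∑ t : Fin k₁ → Λ,
    (H.V k₁ t : ℂ) • (List.ofFn fun j => number (t j)).prod

/-- The Hamiltonian. -/
def op : Op Λ :=
  hopping k H.J + H.potential + ∑ i, (H.U i : ℂ) • numberPow i ((k : ℝ) / 2)

open Classical in
/-- `J̄_{i,k₁}`: the total strength of the terms of order `k₁` in `H_0` that involve the site `i`. -/
def barJ (i : Λ) (k₁ : ℕ) : ℝ :=
  ∑ t : Fin k₁ → Λ with i ∈ Set.range t, ∑ s : Fin (k₁ + 1), ‖H.J k₁ s t‖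

/-- `𝒥̄ = max_i ∑_{k₁=1}^{k} J̄_{i,k₁} (1 + (2 k₁)^{k₁})`. -/
def barJcal : ℝ :=
  ⨆ i, ∑ k₁ ∈ Finset.Icc 1 k, H.barJ i k₁ * (1 + (2 * (k₁ : ℝ)) ^ k₁)

/-- The repulsive condition. -/
def Repulsive : Prop := ∀ i, 5 * H.barJ i k < H.U i

/-- The energy `⟨ψ| H |ψ⟩`. -/
def energy (ψ : FockSpace Λ) : ℝ := (expect H.op ψ).re

end BoseHubbard

section States

variable {Λ : Type*}

/-- The moment `⟨ψ| n_i^{k/2} |ψ⟩`. -/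
def moment (k : ℕ) (i : Λ) (ψ : FockSpace Λ) : ℝ := (expect (numberPow i ((k : ℝ) / 2)) ψ).re

/-- Normalized states on which the quadratic form of a degree `k` Hamiltonian is finite:
`⟨ψ| n_i^{k/2} |ψ⟩ < ∞` at every site. On these, `expect` of each monomial of degree at most `k` in
the `b_i`, `b_i†` is an absolutely convergent sum. -/
def IsState (k : ℕ) (ψ : FockSpace Λ) : Prop :=
  ‖ψ‖ = 1 ∧ ∀ i, Summable fun n : Config Λ => ‖ψ n‖ ^ 2 * (n i : ℝ) ^ ((k : ℝ) / 2)

end States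

namespace BoseHubbard

variable {Λ : Type*} [Fintype Λ] [DecidableEq Λ] {k : ℕ} (H : BoseHubbard Λ k)

/-- The spaces in which ground states are sought: the whole Fock space, or, if `H` conserves the
total boson number, the sector with a given total number of bosons. -/
def IsAdmissibleSpace (S : Set (FockSpace Λ)) : Prop :=
  S = Set.univ ∨ (Commute H.op (totalNumber Λ) ∧ ∃ N : ℕ, S = numberSector Λ N)

/-- `Ω` is a (possibly degenerate) ground state of `H` in `S`. -/
def IsGroundState (S : Set (FockSpace Λ)) (Ω : FockSpace Λ) : Prop :=
  Ω ∈ S ∧ IsState k Ω ∧ ∀ ψ ∈ S, IsState k ψ → H.energy Ω ≤ H.energy ψ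

/-- `ℰ_Q`: the infimum of the energy over the states in `S` with
`max_i ⟨n_i^{k/2}⟩ = Q^{k/2}` (it is `⊤` if there are none). -/
def minEnergy (S : Set (FockSpace Λ)) (Q : ℝ) : EReal :=
  ⨅ ψ ∈ {ψ : FockSpace Λ | ψ ∈ S ∧ IsState k ψ ∧ ⨆ i, moment k i ψ = Q ^ ((k : ℝ) / 2)},
    (H.energy ψ : EReal)

/-- `ζ_{i,0} = J̄_{i,k} / (U_i - u - J̄_{i,k})`. -/
def zeta (i : Λ) (u : ℝ) : ℝ := H.barJ i k / (H.U i - u - H.barJ i k)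

/-- The base `(1 - √(1 - 16 ζ²)) / (4 ζ)` of the exponential decay. -/
def decayBase (i : Λ) (u : ℝ) : ℝ :=
  (1 - Real.sqrt (1 - 16 * H.zeta i u ^ 2)) / (4 * H.zeta i u)

/-- The threshold `M_{i,0}`; here `Jc` stands for `𝒥̌`. -/
def threshold (i : Λ) (u Jc : ℝ) : ℝ :=
  max ((2 : ℝ) ^ (2 / (k : ℝ)) * (Jc / (H.U i - H.barJ i k)) ^ 2)
    (((Jc * H.barJ i k + 2 * H.barJcal * (H.U i - u - H.barJ i k)) / (u * H.barJ i k)) ^ 2)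

end BoseHubbard

end Boson

end

set_option linter.unusedSectionVars false

/-! Cut the ground state at the site i into a tail D (at least y bosons) and a head L (fewer). The
head, normalized, is a trial state, so the energy of D above E₀ is at most the two cross terms
⟨D|H|L⟩ and ⟨L|H|D⟩ (`form_tail_le`).

The hypothesis on ℰ_Q bounds that energy from below by G times the largest moment of D, where G =
U_i - J̄_{i,k} - 𝒥̌/√M (`energy_sub_ge`). The cross terms contain only monomials that touch i, and
these move at most k bosons, so L may be replaced by the tail D' cut at y - k. Young's inequality
with a free weight l bounds them by c (l ‖D‖ + l⁻¹ ‖D'‖), with c = J̄_{i,k} + 2𝒥̄/√M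
(`norm_form_tail_head_le`). Here ‖·‖ is `formSize`: the maximum over sites controls monomials that
mix sites, and the entry M^(k/2) · `mass` makes terms of degree below k smaller by 1/√M.

The threshold gives c ≤ ζG. With l = 1/(2ζ) half of ‖D‖ is absorbed, leaving ‖D‖ ≤ (2ζ)² ‖D'‖
(`formSize_tail_le`). As 2ζ is at most the decay base, iterating over blocks of length k gives the
decay (`le_rpow_of_step`). The ground state itself has size at most M^(k/2), which cancels against
the M^(k/2) in front of the mass, so no prefactor remains. -/

namespace Boson

/-! ### Monomials in creation and annihilation operators as weighted shifts -/

noncomputable section Words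

variable {Λ : Type*} [DecidableEq Λ]

/-- A letter `(true, i)` stands for the creation operator at `i`, `(false, i)` for the annihilation
operator at `i`. -/
def letter (x : Bool × Λ) : Op Λ := if x.1 then create x.2 else annihilate x.2

/-- The configuration whose amplitude is read by `letter x` at `n`. -/
def letterShift (x : Bool × Λ) (n : Config Λ) : Config Λ :=
  if x.1 then n - Pi.single x.2 1 else n + Pi.single x.2 1

/-- The coefficient of `letter x` at `n`. -/
def letterCoeff (x : Bool × Λ) (n : Config Λ) : ℝ :=
  if x.1 then Real.sqrt (n x.2 : ℝ) else Real.sqrt ((n x.2 : ℝ) + 1)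

/-- The configuration whose amplitude is read at `n` by the product of the letters of a word. -/
def wordShift : List (Bool × Λ) → Config Λ → Config Λ
  | [], n => n
  | x :: w, n => wordShift w (letterShift x n)

/-- The coefficient at `n` of the product of the letters of a word. -/
def wordCoeff : List (Bool × Λ) → Config Λ → ℝ
  | [], _ => 1
  | x :: w, n => letterCoeff x n * wordCoeff w (letterShift x n)

theorem letter_apply (x : Bool × Λ) (ψ : Config Λ → ℂ) (n : Config Λ) :
    letter x ψ n = (letterCoeff x n : ℂ) * ψ (letterShift x n) := by
  rcases x with ⟨_ | _, i⟩ <;>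
    simp [letter, letterCoeff, letterShift, create, annihilate]

theorem word_apply (w : List (Bool × Λ)) (ψ : Config Λ → ℂ) (n : Config Λ) :
    (w.map letter).prod ψ n = (wordCoeff w n : ℂ) * ψ (wordShift w n) := by
  induction w generalizing n with
  | nil => simp [wordCoeff, wordShift]
  | cons x w ih =>
    simp only [List.map_cons, List.prod_cons, Module.End.mul_apply, letter_apply, ih, wordCoeff,
      wordShift]
    push_cast
    ring

theorem letterCoeff_nonneg (x : Bool × Λ) (n : Config Λ) : 0 ≤ letterCoeff x n := by
  unfold letterCoeff
  split_ifs <;> positivity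

theorem wordCoeff_nonneg (w : List (Bool × Λ)) (n : Config Λ) : 0 ≤ wordCoeff w n := by
  induction w generalizing n with
  | nil => simp [wordCoeff]
  | cons x w ih => exact mul_nonneg (letterCoeff_nonneg x n) (ih _)

theorem letterShift_bounds (x : Bool × Λ) (n : Config Λ) (j : Λ) :
    letterShift x n j ≤ n j + 1 ∧ n j ≤ letterShift x n j + 1 := by
  rcases x with ⟨_ | _, i⟩ <;> by_cases h : j = i
  · subst h; simp [letterShift]; omega
  · simp [letterShift, h]
  · subst h; simp [letterShift]; omega
  · simp [letterShift, h]

theorem wordShift_bounds (w : List (Bool × Λ)) (n : Config Λ) (j : Λ) :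
    wordShift w n j ≤ n j + w.length ∧ n j ≤ wordShift w n j + w.length := by
  induction w generalizing n with
  | nil => simp [wordShift]
  | cons x w ih =>
    have h1 := ih (letterShift x n)
    have h2 := letterShift_bounds x n j
    simp only [wordShift, List.length_cons]
    omega

theorem wordShift_of_notMem (w : List (Bool × Λ)) (n : Config Λ) (j : Λ)
    (h : ∀ x ∈ w, x.2 ≠ j) : wordShift w n j = n j := by
  induction w generalizing n with
  | nil => rfl
  | cons x w ih =>
    have hx : j ≠ x.2 := (h x (by simp)).symm
    rw [wordShift, ih _ fun y hy => h y (by simp [hy])]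
    unfold letterShift
    split_ifs <;> simp [hx]

/-- Truncated subtraction identifies occupations 0 and 1; the factor √n_i of a creation letter
vanishes exactly at the spurious one. -/
theorem letterShift_inj (x : Bool × Λ) {n n' : Config Λ} (hn : letterCoeff x n ≠ 0)
    (hn' : letterCoeff x n' ≠ 0) (h : letterShift x n = letterShift x n') : n = n' := by
  rcases x with ⟨_ | _, i⟩
  · simpa [letterShift] using h
  · have h1 : n i ≠ 0 := fun h0 => hn (by simp [letterCoeff, h0])
    have h2 : n' i ≠ 0 := fun h0 => hn' (by simp [letterCoeff, h0])
    funext j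
    have hj := congrFun h j
    by_cases hji : j = i
    · subst hji
      simp [letterShift] at hj
      omega
    · simpa [letterShift, hji] using hj

theorem wordShift_inj (w : List (Bool × Λ)) {n n' : Config Λ} (hn : wordCoeff w n ≠ 0)
    (hn' : wordCoeff w n' ≠ 0) (h : wordShift w n = wordShift w n') : n = n' := by
  induction w generalizing n n' with
  | nil => exact h
  | cons x w ih =>
    simp only [wordCoeff] at hn hn'
    exact letterShift_inj x (left_ne_zero_of_mul hn) (left_ne_zero_of_mul hn')
      (ih (right_ne_zero_of_mul hn) (right_ne_zero_of_mul hn') h)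

/-- Each letter raises an occupation by at most one, so no factor exceeds the initial occupation
plus the word length under the root. -/
theorem wordCoeff_le_left (w : List (Bool × Λ)) (n : Config Λ) (h : Λ → ℝ)
    (hh : ∀ j, (n j : ℝ) + w.length ≤ h j) :
    wordCoeff w n ≤ (w.map fun x => Real.sqrt (h x.2)).prod := by
  induction w generalizing n with
  | nil => simp [wordCoeff]
  | cons x w ih =>
    simp only [wordCoeff, List.map_cons, List.prod_cons]
    have hx := hh x.2
    push_cast [List.length_cons] at hx
    refine mul_le_mul ?_ (ih _ fun j => ?_) (wordCoeff_nonneg _ _) (Real.sqrt_nonneg _)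
    · have hw : (0 : ℝ) ≤ w.length := by positivity
      unfold letterCoeff
      split_ifs <;> apply Real.sqrt_le_sqrt <;> linarith
    · have h1 : ((letterShift x n j : ℕ) : ℝ) ≤ n j + 1 := by
        exact_mod_cast (letterShift_bounds x n j).1
      have := hh j
      push_cast [List.length_cons] at this
      linarith

/-- The mirror estimate: intermediate occupations are compared with the final configuration. -/
theorem wordCoeff_le_right (w : List (Bool × Λ)) (n : Config Λ) (h : Λ → ℝ)
    (hh : ∀ j, (wordShift w n j : ℝ) + w.length ≤ h j) :
    wordCoeff w n ≤ (w.map fun x => Real.sqrt (h x.2)).prod := by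
  induction w generalizing n with
  | nil => simp [wordCoeff]
  | cons x w ih =>
    simp only [wordCoeff, List.map_cons, List.prod_cons]
    have hx := hh x.2
    simp only [wordShift] at hh hx
    push_cast [List.length_cons] at hx
    refine mul_le_mul ?_ (ih _ fun j => ?_) (wordCoeff_nonneg _ _) (Real.sqrt_nonneg _)
    · have h1 : ((letterShift x n x.2 : ℕ) : ℝ) ≤ wordShift w (letterShift x n) x.2 + w.length := by
        exact_mod_cast (wordShift_bounds w (letterShift x n) x.2).2
      rcases x with ⟨_ | _, i⟩
      · simp only [letterShift, letterCoeff] at h1 hx ⊢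
        simp at h1 hx ⊢
        apply Real.sqrt_le_sqrt
        linarith
      · have h2 : (n i : ℝ) ≤ letterShift (true, i) n i + 1 := by
          exact_mod_cast (letterShift_bounds (true, i) n i).2
        simp only [letterCoeff, if_true]
        apply Real.sqrt_le_sqrt
        linarith
    · have := hh j
      push_cast [List.length_cons] at this
      linarith

/-- The letters of the ordered monomial `monomial s t`. -/
def monomialWord {K : ℕ} (s : Fin (K + 1)) (t : Fin K → Λ) : List (Bool × Λ) :=
  (List.ofFn fun j : Fin K => (decide (¬ (j : ℕ) < (s : ℕ)), t j)).reverse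

theorem monomial_eq_word {K : ℕ} (s : Fin (K + 1)) (t : Fin K → Λ) :
    monomial s t = ((monomialWord s t).map letter).prod := by
  rw [monomial, monomialWord, List.map_reverse, List.map_ofFn]
  congr 3
  funext j
  by_cases h : (j : ℕ) < (s : ℕ) <;> simp [letter, h]

theorem length_monomialWord {K : ℕ} (s : Fin (K + 1)) (t : Fin K → Λ) :
    (monomialWord s t).length = K := by
  simp [monomialWord]

theorem monomialWord_map_prod {K : ℕ} (s : Fin (K + 1)) (t : Fin K → Λ) (f : Λ → ℝ) :
    ((monomialWord s t).map fun x => f x.2).prod = ∏ j, f (t j) := by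
  rw [monomialWord, List.map_reverse, List.prod_reverse, List.map_ofFn, List.prod_ofFn]
  rfl

/-- The weight `∏ j, √(n (t j) + K)` that controls a monomial of degree `K`. -/
def monomialWeight {K : ℕ} (t : Fin K → Λ) (n : Config Λ) : ℝ :=
  ∏ j, Real.sqrt ((n (t j) : ℝ) + K)

theorem monomialWeight_nonneg {K : ℕ} (t : Fin K → Λ) (n : Config Λ) : 0 ≤ monomialWeight t n :=
  Finset.prod_nonneg fun _ _ => Real.sqrt_nonneg _

theorem monomial_apply {K : ℕ} (s : Fin (K + 1)) (t : Fin K → Λ) (ψ : Config Λ → ℂ)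
    (n : Config Λ) :
    monomial s t ψ n
      = (wordCoeff (monomialWord s t) n : ℂ) * ψ (wordShift (monomialWord s t) n) := by
  rw [monomial_eq_word, word_apply]

/-- The product of the two one-sided bounds. In a Cauchy–Schwarz estimate each amplitude then gets
the weight of its own configuration. -/
theorem wordCoeff_sq_le {K : ℕ} (s : Fin (K + 1)) (t : Fin K → Λ) (n : Config Λ) :
    wordCoeff (monomialWord s t) n ^ 2
      ≤ monomialWeight t n * monomialWeight t (wordShift (monomialWord s t) n) := by
  have h1 := wordCoeff_le_left (monomialWord s t) n (fun j => (n j : ℝ) + K)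
    (by simp [length_monomialWord])
  have h2 := wordCoeff_le_right (monomialWord s t) n
    (fun j => (wordShift (monomialWord s t) n j : ℝ) + K) (by simp [length_monomialWord])
  rw [monomialWord_map_prod s t fun j => Real.sqrt ((n j : ℝ) + K)] at h1
  rw [monomialWord_map_prod s t fun j =>
    Real.sqrt ((wordShift (monomialWord s t) n j : ℝ) + K)] at h2
  rw [sq]
  exact mul_le_mul h1 h2 (wordCoeff_nonneg _ _) (monomialWeight_nonneg _ _)

end Words

/-! ### Scalar inequalities for powers of occupation numbers -/

section Powers

theorem add_le_two_mul_max {K : ℕ} (hK : 1 ≤ K) (n : ℕ) :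
    (n : ℝ) + K ≤ 2 * K * max (n : ℝ) 1 := by
  have hK' : (1 : ℝ) ≤ K := by exact_mod_cast hK
  have h1 : (n : ℝ) ≤ max (n : ℝ) 1 := le_max_left _ _
  have h2 : (1 : ℝ) ≤ max (n : ℝ) 1 := le_max_right _ _
  nlinarith

theorem add_rpow_le_of_lt {K k : ℕ} (hK : 1 ≤ K) (hKk : K < k) (n : ℕ) :
    ((n : ℝ) + K) ^ ((K : ℝ) / 2)
      ≤ (1 + (2 * (K : ℝ)) ^ K) * max (n : ℝ) 1 ^ (((k : ℝ) - 1) / 2) := by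
  have hK' : (1 : ℝ) ≤ K := by exact_mod_cast hK
  have hKk' : (K : ℝ) + 1 ≤ k := by exact_mod_cast hKk
  have h2 : (1 : ℝ) ≤ max (n : ℝ) 1 := le_max_right _ _
  calc ((n : ℝ) + K) ^ ((K : ℝ) / 2) ≤ (2 * K * max (n : ℝ) 1) ^ ((K : ℝ) / 2) :=
        Real.rpow_le_rpow (by positivity) (add_le_two_mul_max hK n) (by positivity)
    _ = (2 * (K : ℝ)) ^ ((K : ℝ) / 2) * max (n : ℝ) 1 ^ ((K : ℝ) / 2) :=
        Real.mul_rpow (by positivity) (by positivity)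
    _ ≤ (1 + (2 * (K : ℝ)) ^ K) * max (n : ℝ) 1 ^ (((k : ℝ) - 1) / 2) := by
        have h3 : (2 * (K : ℝ)) ^ ((K : ℝ) / 2) ≤ (2 * (K : ℝ)) ^ K := by
          rw [← Real.rpow_natCast]
          exact Real.rpow_le_rpow_of_exponent_le (by linarith) (by linarith)
        refine mul_le_mul (by linarith) ?_ (by positivity) (by positivity)
        exact Real.rpow_le_rpow_of_exponent_le h2 (by linarith)

/-- Bernoulli's inequality for (n/(n+k))^p with p = k/2 bounds the increment by p k (n+k)^(p-1),
which has lower order. The leading coefficient stays exactly 1, so only J̄_{i,k} competes with U_i.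
-/
theorem add_rpow_le_self {k : ℕ} (hk : 2 ≤ k) (n : ℕ) :
    ((n : ℝ) + k) ^ ((k : ℝ) / 2)
      ≤ (n : ℝ) ^ ((k : ℝ) / 2)
        + (1 + (2 * (k : ℝ)) ^ k) * max (n : ℝ) 1 ^ (((k : ℝ) - 1) / 2) := by
  have hk' : (2 : ℝ) ≤ k := by exact_mod_cast hk
  have hpos : 0 < (n : ℝ) + k := by positivity
  set p : ℝ := (k : ℝ) / 2 with hp
  have hp1 : 1 ≤ p := by rw [hp]; linarith
  have hb := one_add_mul_self_le_rpow_one_add (s := -((k : ℝ) / (n + k)))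
    (by rw [neg_le_neg_iff, div_le_one hpos]; simp) hp1
  have e1 : 1 + -((k : ℝ) / (n + k)) = n / (n + k) := by field_simp; ring
  rw [e1, Real.div_rpow (by positivity) hpos.le, le_div_iff₀ (Real.rpow_pos_of_pos hpos _)] at hb
  have e2 : ((n : ℝ) + k) ^ p = (n + k) ^ (p - 1) * (n + k) := by
    rw [← Real.rpow_add_one hpos.ne']; congr 1; ring
  have e3 : (1 + p * -((k : ℝ) / (n + k))) * ((n : ℝ) + k) ^ p
      = ((n : ℝ) + k) ^ p - p * k * (n + k) ^ (p - 1) := by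
    rw [e2]; field_simp; ring
  rw [e3] at hb
  have h2 : (1 : ℝ) ≤ max (n : ℝ) 1 := le_max_right _ _
  have h4 : ((n : ℝ) + k) ^ (p - 1)
      ≤ (2 * (k : ℝ)) ^ (p - 1) * max (n : ℝ) 1 ^ (((k : ℝ) - 1) / 2) := by
    calc ((n : ℝ) + k) ^ (p - 1) ≤ (2 * k * max (n : ℝ) 1) ^ (p - 1) :=
          Real.rpow_le_rpow (by positivity) (add_le_two_mul_max (by omega) n) (by linarith)
      _ = (2 * (k : ℝ)) ^ (p - 1) * max (n : ℝ) 1 ^ (p - 1) :=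
          Real.mul_rpow (by positivity) (by positivity)
      _ ≤ _ := by
          gcongr
          linarith
  have h5 : p * k * (2 * (k : ℝ)) ^ (p - 1) ≤ 1 + (2 * (k : ℝ)) ^ k := by
    have e4 : (2 * (k : ℝ)) ^ k = (2 * (k : ℝ)) ^ (2 : ℝ) * (2 * (k : ℝ)) ^ ((k : ℝ) - 2) := by
      rw [← Real.rpow_add (by positivity), ← Real.rpow_natCast]; congr 1; ring
    have h6 : (2 * (k : ℝ)) ^ (p - 1) ≤ (2 * (k : ℝ)) ^ ((k : ℝ) - 2) :=
      Real.rpow_le_rpow_of_exponent_le (by linarith) (by rw [hp]; linarith)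
    have h7 : p * k ≤ (2 * (k : ℝ)) ^ (2 : ℝ) := by
      rw [Real.rpow_two, hp]; nlinarith
    have := mul_le_mul h7 h6 (by positivity) (by positivity)
    linarith
  have h8 : p * k * ((n : ℝ) + k) ^ (p - 1)
      ≤ (1 + (2 * (k : ℝ)) ^ k) * max (n : ℝ) 1 ^ (((k : ℝ) - 1) / 2) := by
    calc p * k * ((n : ℝ) + k) ^ (p - 1)
        ≤ p * k * ((2 * (k : ℝ)) ^ (p - 1) * max (n : ℝ) 1 ^ (((k : ℝ) - 1) / 2)) := by
          gcongr
      _ = (p * k * (2 * (k : ℝ)) ^ (p - 1)) * max (n : ℝ) 1 ^ (((k : ℝ) - 1) / 2) := by ring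
      _ ≤ _ := by gcongr
  linarith

/-- Replace both factors by the larger of n and M. This is the source of the gain 1/√M for
lower-order terms. -/
theorem max_rpow_mul_sqrt_le {k : ℕ} (hk : 1 ≤ k) {M : ℝ} (hM : 1 ≤ M) (n : ℕ) :
    max (n : ℝ) 1 ^ (((k : ℝ) - 1) / 2) * Real.sqrt M
      ≤ (n : ℝ) ^ ((k : ℝ) / 2) + M ^ ((k : ℝ) / 2) := by
  have hk' : (1 : ℝ) ≤ k := by exact_mod_cast hk
  have key : ∀ z : ℝ, 0 < z → z ^ (((k : ℝ) - 1) / 2) * Real.sqrt z = z ^ ((k : ℝ) / 2) := by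
    intro z hz
    rw [Real.sqrt_eq_rpow, ← Real.rpow_add hz]
    congr 1; ring
  rcases le_total M (n : ℝ) with h | h
  · have hn : (1 : ℝ) ≤ n := hM.trans h
    rw [max_eq_left hn]
    have h1 := key n (by linarith)
    have h2 : Real.sqrt M ≤ Real.sqrt n := Real.sqrt_le_sqrt h
    have h3 : (0 : ℝ) ≤ (n : ℝ) ^ (((k : ℝ) - 1) / 2) := by positivity
    have h4 : (0 : ℝ) ≤ M ^ ((k : ℝ) / 2) := by positivity
    nlinarith
  · have h1 := key M (by linarith)
    have h2 : max (n : ℝ) 1 ≤ M := max_le h hM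
    have h3 : max (n : ℝ) 1 ^ (((k : ℝ) - 1) / 2) ≤ M ^ (((k : ℝ) - 1) / 2) :=
      Real.rpow_le_rpow (by positivity) h2 (by linarith)
    have h4 : (0 : ℝ) ≤ (n : ℝ) ^ ((k : ℝ) / 2) := by positivity
    have h5 := Real.sqrt_nonneg M
    nlinarith

/-- The constant in the bound of a monomial of degree `K`. -/
noncomputable def monomialConst (k : ℕ) (M : ℝ) (K : ℕ) : ℝ :=
  (if K = k then 1 else 0) + 2 * (1 + (2 * (K : ℝ)) ^ K) / Real.sqrt M

theorem monomialConst_nonneg (k : ℕ) (M : ℝ) (K : ℕ) : 0 ≤ monomialConst k M K := by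
  unfold monomialConst
  split_ifs <;> positivity

theorem add_rpow_le {K k : ℕ} (hk : 2 ≤ k) (hK : 1 ≤ K) (hKk : K ≤ k) {M : ℝ} (hM : 1 ≤ M)
    (n : ℕ) :
    ((n : ℝ) + K) ^ ((K : ℝ) / 2)
      ≤ (if K = k then 1 else 0) * (n : ℝ) ^ ((k : ℝ) / 2)
        + (1 + (2 * (K : ℝ)) ^ K) / Real.sqrt M
          * ((n : ℝ) ^ ((k : ℝ) / 2) + M ^ ((k : ℝ) / 2)) := by
  have hs : 0 < Real.sqrt M := Real.sqrt_pos.2 (by linarith)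
  have h1 := max_rpow_mul_sqrt_le (k := k) (by omega) hM n
  rw [← le_div_iff₀ hs] at h1
  have h2 : (1 + (2 * (K : ℝ)) ^ K) * max (n : ℝ) 1 ^ (((k : ℝ) - 1) / 2)
      ≤ (1 + (2 * (K : ℝ)) ^ K) / Real.sqrt M
          * ((n : ℝ) ^ ((k : ℝ) / 2) + M ^ ((k : ℝ) / 2)) := by
    calc _ ≤ (1 + (2 * (K : ℝ)) ^ K)
          * (((n : ℝ) ^ ((k : ℝ) / 2) + M ^ ((k : ℝ) / 2)) / Real.sqrt M) := by gcongr
      _ = _ := by ring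
  rcases hKk.lt_or_eq with h | h
  · have := add_rpow_le_of_lt hK h n
    rw [if_neg h.ne]
    linarith
  · subst h
    have := add_rpow_le_self hk n
    rw [if_pos rfl]
    linarith

end Powers

/-! ### Form domain and bounds on a single monomial -/

noncomputable section Form

variable {Λ : Type*}

/-- Amplitudes on which the quadratic form of a degree `k` Hamiltonian is finite. -/
def FormDomain (k : ℕ) (φ : Config Λ → ℂ) : Prop :=
  (Summable fun n => ‖φ n‖ ^ 2) ∧
    ∀ j, Summable fun n : Config Λ => ‖φ n‖ ^ 2 * (n j : ℝ) ^ ((k : ℝ) / 2)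

/-- The squared norm of a family of amplitudes. -/
def mass (φ : Config Λ → ℂ) : ℝ := ∑' n, ‖φ n‖ ^ 2

/-- The unnormalized moment of order `k / 2` at the site `j`. -/
def siteMoment (k : ℕ) (j : Λ) (φ : Config Λ → ℂ) : ℝ :=
  ∑' n : Config Λ, ‖φ n‖ ^ 2 * (n j : ℝ) ^ ((k : ℝ) / 2)

/-- The larger of the maximal unnormalized moment and `M ^ (k / 2)` times the squared norm. -/
def formSize (k : ℕ) (M : ℝ) (φ : Config Λ → ℂ) : ℝ :=
  max (⨆ j, siteMoment k j φ) (M ^ ((k : ℝ) / 2) * mass φ)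

theorem mass_nonneg (φ : Config Λ → ℂ) : 0 ≤ mass φ := tsum_nonneg fun _ => by positivity

theorem siteMoment_nonneg (k : ℕ) (j : Λ) (φ : Config Λ → ℂ) : 0 ≤ siteMoment k j φ :=
  tsum_nonneg fun _ => by positivity

theorem siteMoment_le_iSup [Finite Λ] (k : ℕ) (j : Λ) (φ : Config Λ → ℂ) :
    siteMoment k j φ ≤ ⨆ j, siteMoment k j φ :=
  le_ciSup (f := fun j => siteMoment k j φ) (Set.finite_range _).bddAbove j

theorem siteMoment_le_formSize [Finite Λ] (k : ℕ) (M : ℝ) (j : Λ) (φ : Config Λ → ℂ) :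
    siteMoment k j φ ≤ formSize k M φ :=
  (siteMoment_le_iSup k j φ).trans (le_max_left _ _)

theorem formSize_nonneg (k : ℕ) {M : ℝ} (hM : 0 ≤ M) (φ : Config Λ → ℂ) : 0 ≤ formSize k M φ :=
  le_max_of_le_right (mul_nonneg (by positivity) (mass_nonneg φ))

/-- Domination of amplitudes passes to the form domain. -/
theorem FormDomain.mono {k : ℕ} {φ χ : Config Λ → ℂ} (h : FormDomain k χ)
    (hle : ∀ n, ‖φ n‖ ≤ ‖χ n‖) : FormDomain k φ := by
  have hsq : ∀ n, ‖φ n‖ ^ 2 ≤ ‖χ n‖ ^ 2 := fun n => by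
    have := hle n; gcongr
  refine ⟨h.1.of_nonneg_of_le (fun _ => by positivity) hsq, fun j => ?_⟩
  refine (h.2 j).of_nonneg_of_le (fun _ => by positivity) fun n => ?_
  have := hsq n
  gcongr

theorem mass_mono {k : ℕ} {φ χ : Config Λ → ℂ} (h : FormDomain k χ)
    (hle : ∀ n, ‖φ n‖ ≤ ‖χ n‖) : mass φ ≤ mass χ :=
  (h.mono hle).1.tsum_le_tsum (fun n => by have := hle n; gcongr) h.1

theorem siteMoment_mono {k : ℕ} {φ χ : Config Λ → ℂ} (h : FormDomain k χ)
    (hle : ∀ n, ‖φ n‖ ≤ ‖χ n‖) (j : Λ) : siteMoment k j φ ≤ siteMoment k j χ :=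
  ((h.mono hle).2 j).tsum_le_tsum (fun n => by have := hle n; gcongr) (h.2 j)

theorem formSize_mono [Finite Λ] {k : ℕ} {M : ℝ} (hM : 0 ≤ M) {φ χ : Config Λ → ℂ}
    (h : FormDomain k χ) (hle : ∀ n, ‖φ n‖ ≤ ‖χ n‖) : formSize k M φ ≤ formSize k M χ := by
  refine max_le_max ?_ ?_
  · exact ciSup_mono (Set.finite_range _).bddAbove fun j => siteMoment_mono h hle j
  · exact mul_le_mul_of_nonneg_left (mass_mono h hle) (by positivity)

theorem summable_shifted_moment {k K : ℕ} (hk : 2 ≤ k) (hK : 1 ≤ K) (hKk : K ≤ k)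
    {φ : Config Λ → ℂ} (h : FormDomain k φ) (j : Λ) :
    Summable fun n : Config Λ => ‖φ n‖ ^ 2 * ((n j : ℝ) + K) ^ ((K : ℝ) / 2) := by
  have hs := ((h.2 j).mul_left (if K = k then (1 : ℝ) else 0)).add
    (((h.2 j).add (h.1.mul_right ((1 : ℝ) ^ ((k : ℝ) / 2)))).mul_left
      ((1 + (2 * (K : ℝ)) ^ K) / Real.sqrt 1))
  refine hs.of_nonneg_of_le (fun _ => by positivity) fun n => ?_
  have := mul_le_mul_of_nonneg_left (add_rpow_le hk hK hKk le_rfl (n j))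
    (sq_nonneg ‖φ n‖)
  refine this.trans (le_of_eq ?_)
  ring

/-- The moment and the M-weighted mass are each at most `formSize`, whence the factor 2 in
`monomialConst`. -/
theorem shifted_moment_le [Finite Λ] {k K : ℕ} (hk : 2 ≤ k) (hK : 1 ≤ K) (hKk : K ≤ k)
    {M : ℝ} (hM : 1 ≤ M) {φ : Config Λ → ℂ} (h : FormDomain k φ) (j : Λ) :
    ∑' n : Config Λ, ‖φ n‖ ^ 2 * ((n j : ℝ) + K) ^ ((K : ℝ) / 2)
      ≤ monomialConst k M K * formSize k M φ := by
  have s1 := (h.2 j).mul_left (if K = k then (1 : ℝ) else 0)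
  have s2 := (h.2 j).add (h.1.mul_right (M ^ ((k : ℝ) / 2)))
  have s3 := s2.mul_left ((1 + (2 * (K : ℝ)) ^ K) / Real.sqrt M)
  calc ∑' n : Config Λ, ‖φ n‖ ^ 2 * ((n j : ℝ) + K) ^ ((K : ℝ) / 2)
      ≤ ∑' n : Config Λ, ((if K = k then (1 : ℝ) else 0)
            * (‖φ n‖ ^ 2 * (n j : ℝ) ^ ((k : ℝ) / 2))
          + (1 + (2 * (K : ℝ)) ^ K) / Real.sqrt M
            * (‖φ n‖ ^ 2 * (n j : ℝ) ^ ((k : ℝ) / 2) + ‖φ n‖ ^ 2 * M ^ ((k : ℝ) / 2))) := by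
        refine (summable_shifted_moment hk hK hKk h j).tsum_le_tsum (fun n => ?_) (s1.add s3)
        have := mul_le_mul_of_nonneg_left (add_rpow_le hk hK hKk hM (n j)) (sq_nonneg ‖φ n‖)
        refine this.trans (le_of_eq ?_)
        ring
    _ = (if K = k then (1 : ℝ) else 0) * siteMoment k j φ
          + (1 + (2 * (K : ℝ)) ^ K) / Real.sqrt M
            * (siteMoment k j φ + M ^ ((k : ℝ) / 2) * mass φ) := by
        rw [s1.tsum_add s3, tsum_mul_left, tsum_mul_left,
          (h.2 j).tsum_add (h.1.mul_right _), tsum_mul_right, siteMoment, mass]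
        ring
    _ ≤ (if K = k then (1 : ℝ) else 0) * formSize k M φ
          + (1 + (2 * (K : ℝ)) ^ K) / Real.sqrt M * (formSize k M φ + formSize k M φ) := by
        have h1 := siteMoment_le_formSize k M j φ
        have h2 : M ^ ((k : ℝ) / 2) * mass φ ≤ formSize k M φ := le_max_right _ _
        refine add_le_add (mul_le_mul_of_nonneg_left h1 (by split_ifs <;> norm_num)) ?_
        exact mul_le_mul_of_nonneg_left (add_le_add h1 h2) (by positivity)
    _ = monomialConst k M K * formSize k M φ := by
        rw [monomialConst]; ring

/-- AM–GM over the K factors reduces mixed products to single-site powers. -/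
theorem monomialWeight_le {K : ℕ} (hK : 1 ≤ K) (t : Fin K → Λ) (n : Config Λ) :
    monomialWeight t n ≤ ∑ j, (1 / (K : ℝ)) * ((n (t j) : ℝ) + K) ^ ((K : ℝ) / 2) := by
  have hK' : (0 : ℝ) < K := by exact_mod_cast hK
  have h := Real.geom_mean_le_arith_mean_weighted Finset.univ (fun _ : Fin K => 1 / (K : ℝ))
    (fun j => ((n (t j) : ℝ) + K) ^ ((K : ℝ) / 2)) (fun _ _ => by positivity)
    (by simp; field_simp) (fun _ _ => by positivity)
  refine le_trans (le_of_eq ?_) h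
  refine Finset.prod_congr rfl fun j _ => ?_
  rw [← Real.rpow_mul (by positivity), Real.sqrt_eq_rpow]
  congr 1
  field_simp

theorem summable_monomialWeight {k K : ℕ} (hk : 2 ≤ k) (hK : 1 ≤ K) (hKk : K ≤ k)
    {φ : Config Λ → ℂ} (h : FormDomain k φ) (t : Fin K → Λ) :
    Summable fun n : Config Λ => ‖φ n‖ ^ 2 * monomialWeight t n := by
  have hs : Summable fun n : Config Λ =>
      ∑ j, (1 / (K : ℝ)) * (‖φ n‖ ^ 2 * ((n (t j) : ℝ) + K) ^ ((K : ℝ) / 2)) :=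
    summable_sum fun j _ => (summable_shifted_moment hk hK hKk h (t j)).mul_left _
  refine hs.of_nonneg_of_le
    (fun n => mul_nonneg (by positivity) (Finset.prod_nonneg fun _ _ => Real.sqrt_nonneg _))
    fun n => ?_
  refine (mul_le_mul_of_nonneg_left (monomialWeight_le hK t n) (sq_nonneg ‖φ n‖)).trans ?_
  rw [Finset.mul_sum]
  exact le_of_eq (Finset.sum_congr rfl fun j _ => by ring)

theorem tsum_monomialWeight_le [Finite Λ] {k K : ℕ} (hk : 2 ≤ k) (hK : 1 ≤ K) (hKk : K ≤ k)
    {M : ℝ} (hM : 1 ≤ M) {φ : Config Λ → ℂ} (h : FormDomain k φ) (t : Fin K → Λ) :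
    ∑' n : Config Λ, ‖φ n‖ ^ 2 * monomialWeight t n
      ≤ monomialConst k M K * formSize k M φ := by
  have hK' : (0 : ℝ) < K := by exact_mod_cast hK
  have hj : ∀ j ∈ Finset.univ, Summable fun n : Config Λ =>
      (1 / (K : ℝ)) * (‖φ n‖ ^ 2 * ((n (t j) : ℝ) + K) ^ ((K : ℝ) / 2)) :=
    fun j _ => (summable_shifted_moment hk hK hKk h (t j)).mul_left _
  calc ∑' n : Config Λ, ‖φ n‖ ^ 2 * monomialWeight t n
      ≤ ∑' n : Config Λ, ∑ j, (1 / (K : ℝ))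
          * (‖φ n‖ ^ 2 * ((n (t j) : ℝ) + K) ^ ((K : ℝ) / 2)) := by
        refine (summable_monomialWeight hk hK hKk h t).tsum_le_tsum (fun n => ?_)
          (summable_sum hj)
        refine (mul_le_mul_of_nonneg_left (monomialWeight_le hK t n) (sq_nonneg ‖φ n‖)).trans ?_
        rw [Finset.mul_sum]
        exact le_of_eq (Finset.sum_congr rfl fun j _ => by ring)
    _ = ∑ j, (1 / (K : ℝ))
          * ∑' n : Config Λ, (‖φ n‖ ^ 2 * ((n (t j) : ℝ) + K) ^ ((K : ℝ) / 2)) := by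
        rw [Summable.tsum_finsetSum hj]
        exact Finset.sum_congr rfl fun j _ => tsum_mul_left
    _ ≤ ∑ _j : Fin K, (1 / (K : ℝ)) * (monomialConst k M K * formSize k M φ) := by
        gcongr with j
        exact shifted_moment_le hk hK hKk hM h (t j)
    _ = monomialConst k M K * formSize k M φ := by
        simp; field_simp

variable [DecidableEq Λ]

/-- Young's inequality with weight l applied to `wordCoeff_sq_le`. The indicator restricts to
configurations where the shift is injective, so that the second term can be summed by a change of
variables. -/
theorem norm_mul_norm_monomial_le {K : ℕ} (s : Fin (K + 1)) (t : Fin K → Λ)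
    (φ χ : Config Λ → ℂ) {l : ℝ} (hl : 0 < l) (n : Config Λ) :
    ‖φ n‖ * ‖monomial s t χ n‖
      ≤ (l * (‖φ n‖ ^ 2 * monomialWeight t n)
        + l⁻¹ * {n | wordCoeff (monomialWord s t) n ≠ 0}.indicator
            (fun n => ‖χ (wordShift (monomialWord s t) n)‖ ^ 2
              * monomialWeight t (wordShift (monomialWord s t) n)) n) / 2 := by
  have hw := monomialWeight_nonneg t n
  by_cases hc : wordCoeff (monomialWord s t) n = 0
  · rw [monomial_apply, hc, Set.indicator_of_notMem (by simpa using hc)]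
    simp only [Complex.ofReal_zero, zero_mul, norm_zero, mul_zero, add_zero]
    positivity
  · rw [Set.indicator_of_mem (by simpa using hc), monomial_apply, norm_mul, Complex.norm_real,
      Real.norm_of_nonneg (wordCoeff_nonneg _ _)]
    have hw' := monomialWeight_nonneg t (wordShift (monomialWord s t) n)
    have hsq := wordCoeff_sq_le s t n
    set c := wordCoeff (monomialWord s t) n
    set a := ‖φ n‖
    set b := ‖χ (wordShift (monomialWord s t) n)‖
    set F := monomialWeight t n
    set F' := monomialWeight t (wordShift (monomialWord s t) n)
    have ha : 0 ≤ a := norm_nonneg _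
    have hb : 0 ≤ b := norm_nonneg _
    have hc' : c ≤ Real.sqrt F * Real.sqrt F' := by
      rw [← Real.sqrt_mul hw]
      exact Real.le_sqrt_of_sq_le hsq
    have h1 : a * (c * b) ≤ (a * Real.sqrt F) * (b * Real.sqrt F') := by
      have := mul_le_mul_of_nonneg_left hc' (mul_nonneg ha hb)
      nlinarith
    have h2 : (a * Real.sqrt F) ^ 2 = a ^ 2 * F := by rw [mul_pow, Real.sq_sqrt hw]
    have h3 : (b * Real.sqrt F') ^ 2 = b ^ 2 * F' := by rw [mul_pow, Real.sq_sqrt hw']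
    rw [← h2, ← h3]
    refine h1.trans ?_
    set X := a * Real.sqrt F
    set Y := b * Real.sqrt F'
    have h4 : l * X ^ 2 + l⁻¹ * Y ^ 2 - 2 * (X * Y) = l⁻¹ * (l * X - Y) ^ 2 := by
      field_simp; ring
    have h5 : 0 ≤ l⁻¹ * (l * X - Y) ^ 2 := by positivity
    linarith

theorem summable_indicator_comp_wordShift (w : List (Bool × Λ)) {f : Config Λ → ℝ}
    (hf : Summable f) :
    Summable ({n | wordCoeff w n ≠ 0}.indicator fun n => f (wordShift w n)) := by
  rw [← summable_subtype_iff_indicator]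
  exact hf.comp_injective (i := fun n : {n | wordCoeff w n ≠ 0} => wordShift w n)
    fun n n' h => Subtype.ext (wordShift_inj w n.2 n'.2 h)

theorem tsum_indicator_comp_wordShift_le (w : List (Bool × Λ)) {f : Config Λ → ℝ}
    (hf : Summable f) (h0 : ∀ n, 0 ≤ f n) :
    ∑' n, {n | wordCoeff w n ≠ 0}.indicator (fun n => f (wordShift w n)) n ≤ ∑' n, f n := by
  rw [← tsum_subtype]
  exact tsum_comp_le_tsum_of_inj hf h0
    (i := fun n : {n | wordCoeff w n ≠ 0} => wordShift w n)
    fun n n' h => Subtype.ext (wordShift_inj w n.2 n'.2 h)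

theorem summable_monomial_form {k K : ℕ} (hk : 2 ≤ k) (hK : 1 ≤ K) (hKk : K ≤ k)
    {φ χ : Config Λ → ℂ} (hφ : FormDomain k φ) (hχ : FormDomain k χ)
    (s : Fin (K + 1)) (t : Fin K → Λ) :
    Summable fun n => ‖φ n‖ * ‖monomial s t χ n‖ := by
  have h1 := (summable_monomialWeight hk hK hKk hφ t).mul_left (1 : ℝ)
  have h2 := (summable_indicator_comp_wordShift (monomialWord s t)
    (summable_monomialWeight hk hK hKk hχ t)).mul_left (1 : ℝ)⁻¹
  exact ((h1.add h2).div_const 2).of_nonneg_of_le (fun _ => by positivity)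
    (norm_mul_norm_monomial_le s t φ χ one_pos)

theorem tsum_monomial_form_le [Finite Λ] {k K : ℕ} (hk : 2 ≤ k) (hK : 1 ≤ K) (hKk : K ≤ k)
    {M : ℝ} (hM : 1 ≤ M) {φ χ : Config Λ → ℂ} (hφ : FormDomain k φ) (hχ : FormDomain k χ)
    (s : Fin (K + 1)) (t : Fin K → Λ) {l : ℝ} (hl : 0 < l) :
    ∑' n, ‖φ n‖ * ‖monomial s t χ n‖
      ≤ monomialConst k M K * ((l * formSize k M φ + l⁻¹ * formSize k M χ) / 2) := by
  have h1 := summable_monomialWeight hk hK hKk hφ t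
  have h2 := summable_monomialWeight hk hK hKk hχ t
  have h3 := summable_indicator_comp_wordShift (monomialWord s t) h2
  have h4 := tsum_indicator_comp_wordShift_le (monomialWord s t) h2
    fun n => mul_nonneg (by positivity) (monomialWeight_nonneg t n)
  have h5 := tsum_monomialWeight_le hk hK hKk hM hφ t
  have h6 := tsum_monomialWeight_le hk hK hKk hM hχ t
  have h7 := (summable_monomial_form hk hK hKk hφ hχ s t).tsum_le_tsum
    (norm_mul_norm_monomial_le s t φ χ hl) (((h1.mul_left l).add (h3.mul_left l⁻¹)).div_const 2)
  rw [tsum_div_const, (h1.mul_left l).tsum_add (h3.mul_left l⁻¹), tsum_mul_left,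
    tsum_mul_left] at h7
  have h8 := mul_le_mul_of_nonneg_left h5 hl.le
  have h9 := mul_le_mul_of_nonneg_left (h4.trans h6) (inv_nonneg.2 hl.le)
  linarith

end Form

/-! ### The quadratic form of the Hamiltonian -/

noncomputable section HamiltonianForm

variable {Λ : Type*}

/-- The sesquilinear form `⟨φ| A |χ⟩`. -/
def form (A : Op Λ) (φ χ : Config Λ → ℂ) : ℂ := ∑' n, conj (φ n) * A χ n

theorem form_add_add (A : Op Λ) {φ φ' : Config Λ → ℂ}
    (h11 : Summable fun n => conj (φ n) * A φ n) (h12 : Summable fun n => conj (φ n) * A φ' n)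
    (h21 : Summable fun n => conj (φ' n) * A φ n)
    (h22 : Summable fun n => conj (φ' n) * A φ' n) :
    form A (φ + φ') (φ + φ') = form A φ φ + form A φ φ' + (form A φ' φ + form A φ' φ') := by
  unfold form
  rw [← h11.tsum_add h12, ← h21.tsum_add h22, ← (h11.add h12).tsum_add (h21.add h22)]
  refine tsum_congr fun n => ?_
  simp only [map_add, Pi.add_apply]
  ring

variable [DecidableEq Λ]

theorem number_list_prod_apply {K : ℕ} (t : Fin K → Λ) (ψ : Config Λ → ℂ) (n : Config Λ) :
    (List.ofFn fun j => number (t j)).prod ψ n = ((∏ j, (n (t j) : ℝ) : ℝ) : ℂ) * ψ n := by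
  induction K with
  | zero => simp
  | succ K ih =>
    rw [List.ofFn_succ, List.prod_cons, Module.End.mul_apply, number_eq_diagonal,
      Fin.prod_univ_succ]
    have := ih (fun j => t j.succ)
    simp only [diagonal, LinearMap.coe_mk, AddHom.coe_mk]
    rw [this]
    push_cast
    ring

variable [Fintype Λ] {k : ℕ} (H : BoseHubbard Λ k)

/-- The part of the Hamiltonian that is diagonal in the Mott basis. -/
def BoseHubbard.diagPart (n : Config Λ) : ℝ :=
  ∑ K ∈ Finset.Icc 1 (k / 2), ∑ t : Fin K → Λ, H.V K t * ∏ j, (n (t j) : ℝ)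
    + ∑ j, H.U j * (n j : ℝ) ^ ((k : ℝ) / 2)

theorem hopping_apply (J : (K : ℕ) → Fin (K + 1) → (Fin K → Λ) → ℂ) (χ : Config Λ → ℂ)
    (n : Config Λ) :
    hopping k J χ n = ∑ K ∈ Finset.Icc 1 k, ∑ t : Fin K → Λ, ∑ s : Fin (K + 1),
      J K s t * monomial s t χ n := by
  simp [hopping, LinearMap.sum_apply, Finset.sum_apply]

theorem BoseHubbard.op_apply (χ : Config Λ → ℂ) (n : Config Λ) :
    H.op χ n = hopping k H.J χ n + (H.diagPart n : ℂ) * χ n := by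
  have h1 : H.potential χ n = ((∑ K ∈ Finset.Icc 1 (k / 2), ∑ t : Fin K → Λ,
      H.V K t * ∏ j, (n (t j) : ℝ) : ℝ) : ℂ) * χ n := by
    simp only [BoseHubbard.potential, LinearMap.sum_apply, Finset.sum_apply,
      LinearMap.smul_apply, Pi.smul_apply, smul_eq_mul, number_list_prod_apply]
    push_cast
    simp only [Finset.sum_mul, mul_assoc]
  have h2 : (∑ i, (H.U i : ℂ) • numberPow i ((k : ℝ) / 2) : Op Λ) χ n
      = ((∑ j, H.U j * (n j : ℝ) ^ ((k : ℝ) / 2) : ℝ) : ℂ) * χ n := by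
    simp only [LinearMap.sum_apply, Finset.sum_apply, LinearMap.smul_apply, Pi.smul_apply,
      smul_eq_mul, numberPow, diagonal, LinearMap.coe_mk, AddHom.coe_mk]
    rw [Complex.ofReal_sum, Finset.sum_mul]
    refine Finset.sum_congr rfl fun j _ => ?_
    rw [Complex.ofReal_mul, mul_assoc]
  rw [BoseHubbard.op, LinearMap.add_apply, LinearMap.add_apply, Pi.add_apply, Pi.add_apply, h1, h2,
    BoseHubbard.diagPart]
  push_cast
  ring

/-- Bound by the largest factor to the power K ≤ k/2: the degree limit on V_+ makes it finite on the
form domain. -/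
theorem prod_occupation_le {K : ℕ} (hK : K ∈ Finset.Icc 1 (k / 2)) (t : Fin K → Λ)
    (n : Config Λ) :
    ∏ j, (n (t j) : ℝ) ≤ 1 + ∑ j, (n j : ℝ) ^ ((k : ℝ) / 2) := by
  rw [Finset.mem_Icc] at hK
  have : Nonempty (Fin K) := ⟨⟨0, by omega⟩⟩
  obtain ⟨j₀, -, hj₀⟩ := Finset.exists_max_image Finset.univ (fun j => n (t j))
    Finset.univ_nonempty
  have h1 : ∏ j, (n (t j) : ℝ) ≤ (n (t j₀) : ℝ) ^ K := by
    have := Finset.prod_le_pow_card (Finset.univ : Finset (Fin K)) (fun j => n (t j)) (n (t j₀)) hj₀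
    rw [Finset.card_univ, Fintype.card_fin] at this
    exact_mod_cast this
  have h2 : (n (t j₀) : ℝ) ^ K ≤ 1 + (n (t j₀) : ℝ) ^ ((k : ℝ) / 2) := by
    rcases Nat.eq_zero_or_pos (n (t j₀)) with h | h
    · have : (0 : ℝ) ≤ (n (t j₀) : ℝ) ^ ((k : ℝ) / 2) := by positivity
      rw [h] at this ⊢
      rw [Nat.cast_zero, zero_pow (by omega)] at *
      linarith
    · have h3 : (1 : ℝ) ≤ n (t j₀) := by exact_mod_cast h
      have h4 : (K : ℝ) ≤ (k : ℝ) / 2 := by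
        have : K * 2 ≤ k := by omega
        have : (K : ℝ) * 2 ≤ k := by exact_mod_cast this
        linarith
      have := Real.rpow_le_rpow_of_exponent_le h3 h4
      rw [Real.rpow_natCast] at this
      linarith
  have h3 : (n (t j₀) : ℝ) ^ ((k : ℝ) / 2) ≤ ∑ j, (n j : ℝ) ^ ((k : ℝ) / 2) :=
    Finset.single_le_sum (f := fun j => (n j : ℝ) ^ ((k : ℝ) / 2))
      (fun _ _ => by positivity) (Finset.mem_univ _)
  linarith

theorem BoseHubbard.diagPart_nonneg (n : Config Λ) : 0 ≤ H.diagPart n := by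
  refine add_nonneg (Finset.sum_nonneg fun K _ => Finset.sum_nonneg fun t _ => ?_)
    (Finset.sum_nonneg fun j _ => ?_)
  · exact mul_nonneg (H.V_nonneg K t) (Finset.prod_nonneg fun _ _ => by positivity)
  · exact mul_nonneg (H.U_pos j).le (by positivity)

theorem summable_diagPart {φ : Config Λ → ℂ} (hφ : FormDomain k φ) :
    Summable fun n => ‖φ n‖ ^ 2 * H.diagPart n := by
  have h0 : Summable fun n : Config Λ =>
      ‖φ n‖ ^ 2 * (1 + ∑ j, (n j : ℝ) ^ ((k : ℝ) / 2)) := by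
    simp only [mul_add, mul_one, Finset.mul_sum]
    exact hφ.1.add (summable_sum fun j _ => hφ.2 j)
  simp only [BoseHubbard.diagPart, mul_add, Finset.mul_sum]
  refine (summable_sum fun K hK => summable_sum fun t _ => ?_).add (summable_sum fun j _ => ?_)
  · refine (h0.mul_left (H.V K t)).of_nonneg_of_le (fun n => ?_) fun n => ?_
    · exact mul_nonneg (by positivity)
        (mul_nonneg (H.V_nonneg K t) (Finset.prod_nonneg fun _ _ => by positivity))
    · have h1 := mul_le_mul_of_nonneg_left (prod_occupation_le hK t n)
        (mul_nonneg (H.V_nonneg K t) (sq_nonneg ‖φ n‖))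
      linarith
  · exact ((hφ.2 j).mul_left (H.U j)).congr fun n => by ring

theorem summable_form (hk : 2 ≤ k) {φ χ : Config Λ → ℂ} (hφ : FormDomain k φ)
    (hχ : FormDomain k χ) : Summable fun n => conj (φ n) * H.op χ n := by
  have h1 : Summable fun n => conj (φ n) * hopping k H.J χ n := by
    simp only [hopping_apply, Finset.mul_sum]
    refine summable_sum fun K hK => summable_sum fun t _ => summable_sum fun s _ => ?_
    rw [Finset.mem_Icc] at hK
    refine Summable.of_norm ?_
    refine ((summable_monomial_form hk hK.1 hK.2 hφ hχ s t).mul_left ‖H.J K s t‖).congr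
      fun n => ?_
    simp only [norm_mul, RCLike.norm_conj]
    ring
  have h2 : Summable fun n => conj (φ n) * ((H.diagPart n : ℂ) * χ n) := by
    refine Summable.of_norm_bounded
      (((summable_diagPart H hφ).add (summable_diagPart H hχ)).div_const 2) fun n => ?_
    have h0 := H.diagPart_nonneg n
    rw [norm_mul, norm_mul, RCLike.norm_conj, Complex.norm_real, Real.norm_of_nonneg h0]
    have := mul_nonneg h0 (sq_nonneg (‖φ n‖ - ‖χ n‖))
    nlinarith
  refine (h1.add h2).congr fun n => ?_
  rw [H.op_apply, mul_add]

/-- The bound on the matrix elements of the Hamiltonian between two families of amplitudes that are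
separated by the occupation number of the site `i`. -/
theorem norm_form_le (hk : 2 ≤ k) {M : ℝ} (hM : 1 ≤ M) (i : Λ) {φ χ φ' χ' : Config Λ → ℂ}
    (hφ : FormDomain k φ) (hχ : FormDomain k χ)
    (hφ' : FormDomain k φ') (hχ' : FormDomain k χ')
    (hsep : ∀ n m : Config Λ, m i = n i → φ n = 0 ∨ χ m = 0)
    (hle : ∀ n m : Config Λ, n i ≤ m i + k → m i ≤ n i + k →
      ‖φ n‖ * ‖χ m‖ ≤ ‖φ' n‖ * ‖χ' m‖) {l : ℝ} (hl : 0 < l) :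
    ‖form H.op φ χ‖ ≤ (∑ K ∈ Finset.Icc 1 k, H.barJ i K * monomialConst k M K)
      * ((l * formSize k M φ' + l⁻¹ * formSize k M χ') / 2) := by
  classical
  set B := (l * formSize k M φ' + l⁻¹ * formSize k M χ') / 2 with hB
  have hB0 : 0 ≤ B := by
    have := formSize_nonneg k (by linarith : (0 : ℝ) ≤ M) φ'
    have := formSize_nonneg k (by linarith : (0 : ℝ) ≤ M) χ'
    positivity
  have hterm : ∀ K ∈ Finset.Icc 1 k, ∀ (t : Fin K → Λ) (s : Fin (K + 1)),
      ‖∑' n, conj (φ n) * (H.J K s t * monomial s t χ n)‖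
        ≤ if i ∈ Set.range t then ‖H.J K s t‖ * (monomialConst k M K * B) else 0 := by
    intro K hK t s
    rw [Finset.mem_Icc] at hK
    split_ifs with hi
    -- A word of length K ≤ k changes n_i by at most k, so `hle` applies to the pair of
    -- configurations it connects.
    · have hn : ∀ n, ‖conj (φ n) * (H.J K s t * monomial s t χ n)‖
          ≤ ‖H.J K s t‖ * (‖φ' n‖ * ‖monomial s t χ' n‖) := by
        intro n
        rw [norm_mul, norm_mul, RCLike.norm_conj, monomial_apply, monomial_apply, norm_mul,
          norm_mul]
        have hb := wordShift_bounds (monomialWord s t) n i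
        rw [length_monomialWord] at hb
        have := mul_le_mul_of_nonneg_left (hle n (wordShift (monomialWord s t) n)
          (by omega) (by omega))
          (mul_nonneg (norm_nonneg (H.J K s t))
            (norm_nonneg (wordCoeff (monomialWord s t) n : ℂ)))
        linarith
      have hs := (summable_monomial_form hk hK.1 hK.2 hφ' hχ' s t).mul_left ‖H.J K s t‖
      refine (tsum_of_norm_bounded hs.hasSum hn).trans ?_
      rw [tsum_mul_left]
      exact mul_le_mul_of_nonneg_left (tsum_monomial_form_le hk hK.1 hK.2 hM hφ' hχ' s t hl)
        (norm_nonneg _)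
    -- A monomial that misses i preserves n_i and cannot connect the separated supports; hence only
    -- `barJ i` enters.
    · have hz : ∀ n, conj (φ n) * (H.J K s t * monomial s t χ n) = 0 := by
        intro n
        have hfix := wordShift_of_notMem (monomialWord s t) n i (by
          intro x hx hxi
          simp only [monomialWord, List.mem_reverse, List.mem_ofFn] at hx
          obtain ⟨j, rfl⟩ := hx
          exact hi ⟨j, hxi⟩)
        rw [monomial_apply]
        rcases hsep n _ hfix with h | h <;> simp [h]
      simp [hz]
  have hsum : ∀ K ∈ Finset.Icc 1 k, ∀ (t : Fin K → Λ) (s : Fin (K + 1)),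
      Summable fun n => conj (φ n) * (H.J K s t * monomial s t χ n) := by
    intro K hK t s
    rw [Finset.mem_Icc] at hK
    refine Summable.of_norm ?_
    refine ((summable_monomial_form hk hK.1 hK.2 hφ hχ s t).mul_left ‖H.J K s t‖).congr
      fun n => ?_
    simp only [norm_mul, RCLike.norm_conj]
    ring
  have hform : form H.op φ χ = ∑ K ∈ Finset.Icc 1 k, ∑ t : Fin K → Λ, ∑ s : Fin (K + 1),
      ∑' n, conj (φ n) * (H.J K s t * monomial s t χ n) := by
    have hp : ∀ n, conj (φ n) * H.op χ n = ∑ K ∈ Finset.Icc 1 k, ∑ t : Fin K → Λ,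
        ∑ s : Fin (K + 1), conj (φ n) * (H.J K s t * monomial s t χ n) := by
      intro n
      have hd : conj (φ n) * ((H.diagPart n : ℂ) * χ n) = 0 := by
        rcases hsep n n rfl with h | h <;> simp [h]
      rw [H.op_apply, mul_add, hd, add_zero, hopping_apply]
      simp only [Finset.mul_sum]
    rw [form, tsum_congr hp, Summable.tsum_finsetSum fun K hK => summable_sum fun t _ =>
      summable_sum fun s _ => hsum K hK t s]
    refine Finset.sum_congr rfl fun K hK => ?_
    rw [Summable.tsum_finsetSum fun t _ => summable_sum fun s _ => hsum K hK t s]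
    refine Finset.sum_congr rfl fun t _ => ?_
    rw [Summable.tsum_finsetSum fun s _ => hsum K hK t s]
  rw [hform, Finset.sum_mul]
  refine (norm_sum_le _ _).trans (Finset.sum_le_sum fun K hK => ?_)
  rw [BoseHubbard.barJ, Finset.sum_filter, Finset.sum_mul, Finset.sum_mul]
  refine (norm_sum_le _ _).trans (Finset.sum_le_sum fun t _ => ?_)
  refine (norm_sum_le _ _).trans ((Finset.sum_le_sum fun s _ => hterm K hK t s).trans ?_)
  split_ifs
  · rw [Finset.sum_mul, Finset.sum_mul]
    exact le_of_eq (Finset.sum_congr rfl fun s _ => by ring)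
  · simp

/-- Normalization of amplitudes supported where a given vector of the space is supported. -/
theorem exists_state {S : Set (FockSpace Λ)} (hS : H.IsAdmissibleSpace S) {Ω : FockSpace Λ}
    (hΩ : Ω ∈ S) {φ : Config Λ → ℂ} (hφ : FormDomain k φ) (hsub : ∀ n, Ω n = 0 → φ n = 0)
    (hpos : 0 < mass φ) :
    ∃ ψ ∈ S, IsState k ψ ∧ H.energy ψ * mass φ = (form H.op φ φ).re ∧
      ∀ j, moment k j ψ * mass φ = siteMoment k j φ := by
  have hmem : Memℓp φ 2 := memℓp_gen (by simpa using hφ.1)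
  set c : ℝ := (Real.sqrt (mass φ))⁻¹ with hc
  have hcc : c ^ 2 * mass φ = 1 := by
    rw [hc, inv_pow, Real.sq_sqrt hpos.le, inv_mul_cancel₀ hpos.ne']
  have hc0 : 0 < c := by positivity
  let Φ : FockSpace Λ := ⟨φ, hmem⟩
  let ψ : FockSpace Λ := (c : ℂ) • Φ
  have hcoe : ((ψ : FockSpace Λ) : Config Λ → ℂ) = (c : ℂ) • φ := rfl
  have hψn : ∀ n, ‖ψ n‖ ^ 2 = c ^ 2 * ‖φ n‖ ^ 2 := by
    intro n
    rw [hcoe, Pi.smul_apply, norm_smul, Complex.norm_real, Real.norm_of_nonneg hc0.le, mul_pow]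
  have hexp : ∀ A : Op Λ, expect A ψ = ((c ^ 2 : ℝ) : ℂ) * form A φ φ := by
    intro A
    rw [expect, form, ← tsum_mul_left]
    refine tsum_congr fun n => ?_
    rw [hcoe, map_smul]
    simp only [Pi.smul_apply, smul_eq_mul, map_mul, Complex.conj_ofReal]
    push_cast
    ring
  have hmom : ∀ j, (form (numberPow j ((k : ℝ) / 2)) φ φ).re = siteMoment k j φ := by
    intro j
    have : form (numberPow j ((k : ℝ) / 2)) φ φ = ((siteMoment k j φ : ℝ) : ℂ) := by
      rw [form, siteMoment, Complex.ofReal_tsum]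
      refine tsum_congr fun n => ?_
      simp only [numberPow, diagonal, LinearMap.coe_mk, AddHom.coe_mk]
      rw [Complex.ofReal_mul, Complex.ofReal_pow, ← Complex.conj_mul']
      ring
    rw [this, Complex.ofReal_re]
  refine ⟨ψ, ?_, ⟨?_, fun j => ?_⟩, ?_, fun j => ?_⟩
  -- The total number is diagonal, so cutting amplitudes of a vector of the sector stays in the
  -- sector.
  · rcases hS with rfl | ⟨-, N, rfl⟩
    · trivial
    · have hdiag : ∀ (χ : Config Λ → ℂ) (n : Config Λ),
          totalNumber Λ χ n = (∑ j, (n j : ℂ)) * χ n := by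
        intro χ n
        simp [totalNumber, number_eq_diagonal, diagonal, LinearMap.sum_apply, Finset.sum_apply,
          Finset.sum_mul]
      change totalNumber Λ ψ = (N : ℂ) • (ψ : Config Λ → ℂ)
      funext n
      rw [hdiag, Pi.smul_apply, smul_eq_mul]
      by_cases h0 : Ω n = 0
      · rw [hcoe, Pi.smul_apply, hsub n h0]; simp
      · have h1 := congrFun (show totalNumber Λ Ω = (N : ℂ) • (Ω : Config Λ → ℂ) from hΩ) n
        rw [hdiag, Pi.smul_apply, smul_eq_mul] at h1
        rw [mul_right_cancel₀ h0 h1]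
  · have h1 := lp.norm_rpow_eq_tsum (p := 2) (by norm_num) ψ
    have h2 : ‖ψ‖ ^ 2 = 1 := by
      have e : ∑' n, ‖ψ n‖ ^ 2 = 1 := by
        rw [tsum_congr hψn, tsum_mul_left]; exact hcc
      simpa [e] using h1
    exact (pow_eq_one_iff_of_nonneg (norm_nonneg ψ) two_ne_zero).1 h2
  · refine ((hφ.2 j).mul_left (c ^ 2)).congr fun n => ?_
    rw [hψn]; ring
  · rw [BoseHubbard.energy, hexp, Complex.re_ofReal_mul]
    linear_combination (form H.op φ φ).re * hcc
  · rw [moment, hexp, Complex.re_ofReal_mul, hmom]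
    linear_combination siteMoment k j φ * hcc

end HamiltonianForm

/-! ### Tails and heads at one site -/

noncomputable section Decay

variable {Λ : Type*}

/-- The amplitudes of `ψ` with at least `y` bosons at the site `i`. -/
def tail (i : Λ) (y : ℝ) (ψ : Config Λ → ℂ) : Config Λ → ℂ := {n | y ≤ (n i : ℝ)}.indicator ψ

/-- The amplitudes of `ψ` with less than `y` bosons at the site `i`. -/
def head (i : Λ) (y : ℝ) (ψ : Config Λ → ℂ) : Config Λ → ℂ := {n | y ≤ (n i : ℝ)}ᶜ.indicator ψ

theorem tail_add_head (i : Λ) (y : ℝ) (ψ : Config Λ → ℂ) : tail i y ψ + head i y ψ = ψ :=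
  Set.indicator_self_add_compl _ _

theorem norm_tail_le (i : Λ) (y : ℝ) (ψ : Config Λ → ℂ) (n : Config Λ) : ‖tail i y ψ n‖ ≤ ‖ψ n‖ :=
  norm_indicator_le_norm_self _ _

theorem norm_head_le (i : Λ) (y : ℝ) (ψ : Config Λ → ℂ) (n : Config Λ) : ‖head i y ψ n‖ ≤ ‖ψ n‖ :=
  norm_indicator_le_norm_self _ _

theorem tail_of_le {i : Λ} {y : ℝ} {n : Config Λ} (h : y ≤ (n i : ℝ)) (ψ : Config Λ → ℂ) :
    tail i y ψ n = ψ n := Set.indicator_of_mem (by exact h) _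

theorem tail_of_lt {i : Λ} {y : ℝ} {n : Config Λ} (h : (n i : ℝ) < y) (ψ : Config Λ → ℂ) :
    tail i y ψ n = 0 := Set.indicator_of_notMem (by simpa using h) _

theorem head_of_le {i : Λ} {y : ℝ} {n : Config Λ} (h : y ≤ (n i : ℝ)) (ψ : Config Λ → ℂ) :
    head i y ψ n = 0 := Set.indicator_of_notMem (by simpa using h) _

theorem head_of_lt {i : Λ} {y : ℝ} {n : Config Λ} (h : (n i : ℝ) < y) (ψ : Config Λ → ℂ) :
    head i y ψ n = ψ n := Set.indicator_of_mem (by simpa using h) _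

theorem eq_zero_of_mass_eq_zero {k : ℕ} {φ : Config Λ → ℂ} (hφ : FormDomain k φ)
    (h : mass φ = 0) : φ = 0 := by
  funext n
  have h1 := hφ.1.le_tsum n fun _ _ => by positivity
  have h2 : ‖φ n‖ ^ 2 ≤ 0 := h1.trans h.le
  have h3 : ‖φ n‖ = 0 := by
    have := norm_nonneg (φ n)
    nlinarith
  exact norm_eq_zero.1 h3

theorem mass_tail_add_mass_head {k : ℕ} {ψ : Config Λ → ℂ} (hψ : FormDomain k ψ) (i : Λ) (y : ℝ) :
    mass (tail i y ψ) + mass (head i y ψ) = mass ψ := by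
  rw [mass, mass, mass, ← (hψ.mono (norm_tail_le i y ψ)).1.tsum_add
    (hψ.mono (norm_head_le i y ψ)).1]
  refine tsum_congr fun n => ?_
  rcases le_or_gt y (n i : ℝ) with h | h
  · rw [tail_of_le h, head_of_le h]; simp
  · rw [tail_of_lt h, head_of_lt h]; simp

/-- Markov's inequality. Only integer occupations matter, so M may exceed y, as happens for 0 < y <
1 = M. -/
theorem mul_mass_tail_le {k : ℕ} {ψ : Config Λ → ℂ} (hψ : FormDomain k ψ) (i : Λ) {y M : ℝ}
    (hM : 0 ≤ M) (hy : ∀ n : ℕ, y ≤ n → M ≤ n) :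
    M ^ ((k : ℝ) / 2) * mass (tail i y ψ) ≤ siteMoment k i (tail i y ψ) := by
  have hD := hψ.mono (norm_tail_le i y ψ)
  rw [mass, siteMoment, ← tsum_mul_left]
  refine (hD.1.mul_left _).tsum_le_tsum (fun n => ?_) (hD.2 i)
  rcases le_or_gt y (n i : ℝ) with h | h
  · rw [mul_comm]
    have := hy _ h
    gcongr
  · rw [tail_of_lt h]; simp

theorem formDomain_of_isState {k : ℕ} {ψ : FockSpace Λ} (h : IsState k ψ) :
    FormDomain k (ψ : Config Λ → ℂ) := by
  refine ⟨?_, h.2⟩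
  have := (lp.memℓp ψ).summable (by norm_num)
  simpa using this

theorem mass_of_isState {k : ℕ} {ψ : FockSpace Λ} (h : IsState k ψ) :
    mass (ψ : Config Λ → ℂ) = 1 := by
  have h1 := lp.norm_rpow_eq_tsum (p := 2) (by norm_num) ψ
  rw [h.1] at h1
  simpa [mass] using h1.symm

theorem expect_projGE (i : Λ) (x : ℝ) (ψ : FockSpace Λ) :
    (expect (projGE i x) ψ).re = mass (tail i x (ψ : Config Λ → ℂ)) := by
  have : expect (projGE i x) ψ = ((mass (tail i x (ψ : Config Λ → ℂ)) : ℝ) : ℂ) := by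
    rw [expect, mass, Complex.ofReal_tsum]
    refine tsum_congr fun n => ?_
    simp only [projGE, diagonal, LinearMap.coe_mk, AddHom.coe_mk]
    rcases le_or_gt x (n i : ℝ) with h | h
    · rw [tail_of_le h, if_pos h, Complex.ofReal_pow, ← Complex.conj_mul']
      simp
    · rw [tail_of_lt h, if_neg h.not_ge]
      simp
  rw [this, Complex.ofReal_re]

theorem moment_eq_siteMoment (k : ℕ) (j : Λ) (ψ : FockSpace Λ) :
    moment k j ψ = siteMoment k j (ψ : Config Λ → ℂ) := by
  have : expect (numberPow j ((k : ℝ) / 2)) ψ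
      = ((siteMoment k j (ψ : Config Λ → ℂ) : ℝ) : ℂ) := by
    rw [expect, siteMoment, Complex.ofReal_tsum]
    refine tsum_congr fun n => ?_
    simp only [numberPow, diagonal, LinearMap.coe_mk, AddHom.coe_mk]
    rw [Complex.ofReal_mul, Complex.ofReal_pow, ← Complex.conj_mul']
    ring
  rw [moment, this, Complex.ofReal_re]

/-! ### Variational inequality, contraction of the tails, and iteration -/

variable [Fintype Λ] [DecidableEq Λ] {k : ℕ} (H : BoseHubbard Λ k)

/-- The lower bound on the minimal energies, for a state whose largest moment is `W`. -/
theorem energy_sub_ge (hk : 3 ≤ k) {S : Set (FockSpace Λ)} {E₀ a Jc : ℝ}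
    (hJc : ∀ Q : ℝ, 0 < Q →
      ((a * Q ^ ((k : ℝ) / 2) - Jc * Q ^ (((k : ℝ) - 1) / 2) : ℝ) : EReal)
        ≤ H.minEnergy S Q - (E₀ : EReal))
    {ψ : FockSpace Λ} (hψS : ψ ∈ S) (hψ : IsState k ψ) {W : ℝ} (hW : ⨆ j, moment k j ψ = W)
    (hW0 : 0 < W) :
    a * W - Jc * (W / W ^ (1 / (k : ℝ))) ≤ H.energy ψ - E₀ := by
  have hk0 : (0 : ℝ) < k := by positivity
  set Q : ℝ := W ^ (2 / (k : ℝ)) with hQ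
  have hQ0 : 0 < Q := Real.rpow_pos_of_pos hW0 _
  have e1 : Q ^ ((k : ℝ) / 2) = W := by
    rw [hQ, ← Real.rpow_mul hW0.le]
    have : 2 / (k : ℝ) * (k / 2) = 1 := by field_simp
    rw [this, Real.rpow_one]
  have e2 : Q ^ (((k : ℝ) - 1) / 2) = W / W ^ (1 / (k : ℝ)) := by
    rw [hQ, ← Real.rpow_mul hW0.le]
    have : 2 / (k : ℝ) * ((k - 1) / 2) = 1 - 1 / k := by field_simp
    rw [this, Real.rpow_sub hW0, Real.rpow_one]
  have h1 := hJc Q hQ0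
  rw [e1, e2] at h1
  have h2 : H.minEnergy S Q ≤ (H.energy ψ : EReal) :=
    iInf₂_le ψ ⟨hψS, hψ, by rw [hW, e1]⟩
  have h3 := h1.trans (EReal.sub_le_sub h2 le_rfl)
  rw [← EReal.coe_sub] at h3
  exact_mod_cast h3

theorem sum_barJ_mul_monomialConst_le (hk : 1 ≤ k) (i : Λ) (M : ℝ) :
    ∑ K ∈ Finset.Icc 1 k, H.barJ i K * monomialConst k M K
      ≤ H.barJ i k + 2 * H.barJcal / Real.sqrt M := by
  have h1 : ∑ K ∈ Finset.Icc 1 k, H.barJ i K * (1 + (2 * (K : ℝ)) ^ K) ≤ H.barJcal :=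
    le_ciSup (f := fun i => ∑ K ∈ Finset.Icc 1 k, H.barJ i K * (1 + (2 * (K : ℝ)) ^ K))
      (Set.finite_range _).bddAbove i
  have h2 : ∑ K ∈ Finset.Icc 1 k, H.barJ i K * monomialConst k M K
      = H.barJ i k + 2 / Real.sqrt M
        * ∑ K ∈ Finset.Icc 1 k, H.barJ i K * (1 + (2 * (K : ℝ)) ^ K) := by
    have e : ∀ K, H.barJ i K * monomialConst k M K = (if K = k then H.barJ i K else 0)
        + 2 / Real.sqrt M * (H.barJ i K * (1 + (2 * (K : ℝ)) ^ K)) := by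
      intro K
      rw [monomialConst]
      split_ifs <;> ring
    rw [Finset.sum_congr rfl fun K _ => e K, Finset.sum_add_distrib, ← Finset.mul_sum,
      Finset.sum_ite_eq' (Finset.Icc 1 k) k, if_pos (by simp [hk])]
  rw [h2]
  have := mul_le_mul_of_nonneg_left h1 (by positivity : 0 ≤ 2 / Real.sqrt M)
  have e : 2 * H.barJcal / Real.sqrt M = 2 / Real.sqrt M * H.barJcal := by ring
  linarith

/-- The variational principle with the head of the ground state as trial state. -/
theorem form_tail_le {S : Set (FockSpace Λ)} (hk : 2 ≤ k) (hS : H.IsAdmissibleSpace S)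
    {Ω : FockSpace Λ} (hΩ : H.IsGroundState S Ω) (i : Λ) (y : ℝ) :
    (form H.op (tail i y Ω) (tail i y Ω)).re - H.energy Ω * mass (tail i y Ω)
      ≤ ‖form H.op (tail i y Ω) (head i y Ω)‖ + ‖form H.op (head i y Ω) (tail i y Ω)‖ := by
  have hdom := formDomain_of_isState hΩ.2.1
  have hD := hdom.mono (norm_tail_le i y _)
  have hL := hdom.mono (norm_head_le i y _)
  have hsplit := form_add_add H.op (summable_form H hk hD hD) (summable_form H hk hD hL)
    (summable_form H hk hL hD) (summable_form H hk hL hL)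
  rw [tail_add_head] at hsplit
  have hE : H.energy Ω = (form H.op Ω Ω).re := rfl
  have hmass := mass_tail_add_mass_head hdom i y
  rw [mass_of_isState hΩ.2.1] at hmass
  have hvar : H.energy Ω * mass (head i y Ω) ≤ (form H.op (head i y Ω) (head i y Ω)).re := by
    -- A head of zero mass cannot be normalized, but then both sides vanish.
    rcases (mass_nonneg (head i y Ω)).eq_or_lt with h0 | h0
    · rw [← h0, eq_zero_of_mass_eq_zero hL h0.symm]
      simp [form]
    · obtain ⟨ψ, hψS, hψ, he, -⟩ := exists_state H hS hΩ.1 hL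
        (fun n hn => by
          have := norm_head_le i y Ω n
          rw [hn, norm_zero] at this
          exact norm_le_zero_iff.1 this) h0
      rw [← he]
      exact mul_le_mul_of_nonneg_right (hΩ.2.2 ψ hψS hψ) h0.le
  have hre := congrArg Complex.re hsplit
  simp only [Complex.add_re] at hre
  rw [← hE] at hre
  have h1 := (abs_le.1 (Complex.abs_re_le_norm (form H.op (tail i y Ω) (head i y Ω)))).1
  have h2 := (abs_le.1 (Complex.abs_re_le_norm (form H.op (head i y Ω) (tail i y Ω)))).1
  have h3 : H.energy Ω * mass (head i y Ω) = H.energy Ω - H.energy Ω * mass (tail i y Ω) := by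
    linear_combination H.energy Ω * hmass
  linarith

/-- Only the part of the head within k below y couples to the tail, and there it is dominated by the
tail cut at y - k. -/
theorem norm_form_tail_head_le (hk : 2 ≤ k) {M : ℝ} (hM : 1 ≤ M) {ψ : Config Λ → ℂ}
    (hψ : FormDomain k ψ) (i : Λ) (y : ℝ) {l : ℝ} (hl : 0 < l) :
    ‖form H.op (tail i y ψ) (head i y ψ)‖ + ‖form H.op (head i y ψ) (tail i y ψ)‖
      ≤ (∑ K ∈ Finset.Icc 1 k, H.barJ i K * monomialConst k M K)
        * (l * formSize k M (tail i y ψ) + l⁻¹ * formSize k M (tail i (y - k) ψ)) := by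
  have hD := hψ.mono (norm_tail_le i y ψ)
  have hL := hψ.mono (norm_head_le i y ψ)
  have hD' := hψ.mono (norm_tail_le i (y - k) ψ)
  have key : ∀ n m : Config Λ, n i ≤ m i + k →
      ‖tail i y ψ n‖ * ‖head i y ψ m‖ ≤ ‖tail i y ψ n‖ * ‖tail i (y - k) ψ m‖ := by
    intro n m hnm
    rcases le_or_gt y (n i : ℝ) with h | h
    · have h1 : (n i : ℝ) ≤ m i + k := by exact_mod_cast hnm
      rw [tail_of_le (i := i) (y := y - k) (n := m) (by linarith)]
      exact mul_le_mul_of_nonneg_left (norm_head_le i y ψ m) (norm_nonneg _)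
    · rw [tail_of_lt h]; simp
  have sep : ∀ n m : Config Λ, m i = n i → tail i y ψ n = 0 ∨ head i y ψ m = 0 := by
    intro n m hnm
    rcases le_or_gt y (n i : ℝ) with h | h
    · exact Or.inr (head_of_le (by rw [hnm]; exact h) ψ)
    · exact Or.inl (tail_of_lt h ψ)
  have h1 := norm_form_le H hk hM i hD hL hD hD' sep (fun n m h _ => key n m h) hl
  -- With the roles exchanged, the weight l⁻¹ puts l on the same tail as before.
  have h2 := norm_form_le H hk hM i hL hD hD' hD (fun n m h => (sep m n h.symm).symm)
    (fun n m _ h => by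
      have := key m n h
      linarith) (inv_pos.2 hl)
  rw [inv_inv] at h2
  linarith

/-- The contraction step: the energy cost of the tail is compared with its coupling to the head, and
the common factor G cancels. -/
theorem formSize_tail_le (hk : 3 ≤ k) {S : Set (FockSpace Λ)} (hS : H.IsAdmissibleSpace S)
    {Ω : FockSpace Λ} (hΩ : H.IsGroundState S Ω) {i : Λ} (hJ : 0 < H.barJ i k)
    {u : ℝ} (hu : 0 < u) (hu' : u < H.U i - 5 * H.barJ i k) {Jc : ℝ} (hJc0 : 0 ≤ Jc)
    (hJc : ∀ Q : ℝ, 0 < Q →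
      (((H.U i - H.barJ i k) * Q ^ ((k : ℝ) / 2) - Jc * Q ^ (((k : ℝ) - 1) / 2) : ℝ) : EReal)
        ≤ H.minEnergy S Q - (H.energy Ω : EReal))
    {M : ℝ} (hM : 1 ≤ M)
    (hth : (Jc * H.barJ i k + 2 * H.barJcal * (H.U i - u - H.barJ i k)) / (u * H.barJ i k)
      ≤ Real.sqrt M)
    {y : ℝ} (hy : ∀ n : ℕ, y ≤ n → M ≤ n) :
    formSize k M (tail i y Ω) ≤ (2 * H.zeta i u) ^ 2 * formSize k M (tail i (y - k) Ω) := by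
  have hM0 : (0 : ℝ) ≤ M := by linarith
  have hk0 : (0 : ℝ) < k := by positivity
  have hdom := formDomain_of_isState hΩ.2.1
  have hD := hdom.mono (norm_tail_le i y _)
  have hg' := formSize_nonneg k hM0 (tail i (y - k) Ω)
  rcases (mass_nonneg (tail i y Ω)).eq_or_lt with h0 | h0
  · have hz : formSize k M (tail i y Ω) = 0 := by
      rw [eq_zero_of_mass_eq_zero hD h0.symm]
      simp [formSize, siteMoment, mass]
    rw [hz]; positivity
  obtain ⟨ψ, hψS, hψ, he, hm⟩ := exists_state H hS hΩ.1 hD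
    (fun n hn => by
      have := norm_tail_le i y Ω n
      rw [hn, norm_zero] at this
      exact norm_le_zero_iff.1 this) h0
  set p := mass (tail i y Ω) with hp
  set W := ⨆ j, moment k j ψ with hW
  have hWp : W * p = ⨆ j, siteMoment k j (tail i y Ω) := by
    rw [hW, Real.iSup_mul_of_nonneg h0.le]
    simp only [hm]
  have hmass := mul_mass_tail_le hdom i hM0 hy
  -- On the tail n_i ≥ M, so the moments win in `formSize`, and the correction 𝒥̌ / W^(1/k) is at
  -- most 𝒥̌ / √M.
  have hWM : M ^ ((k : ℝ) / 2) ≤ W := by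
    refine le_of_mul_le_mul_right ?_ h0
    rw [hWp]
    exact hmass.trans (siteMoment_le_iSup k i _)
  have hsize : formSize k M (tail i y Ω) = W * p := by
    rw [formSize, ← hWp, max_eq_left]
    exact mul_le_mul_of_nonneg_right hWM h0.le
  have hW0 : 0 < W := lt_of_lt_of_le (by positivity) hWM
  have hs : 0 < Real.sqrt M := Real.sqrt_pos.2 (by linarith)
  have hr : Real.sqrt M ≤ W ^ (1 / (k : ℝ)) := by
    have h1 := Real.rpow_le_rpow (by positivity) hWM (by positivity : 0 ≤ 1 / (k : ℝ))
    rw [← Real.rpow_mul hM0] at h1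
    have e : (k : ℝ) / 2 * (1 / k) = 1 / 2 := by field_simp
    rw [e, ← Real.sqrt_eq_rpow] at h1
    exact h1
  have hen := energy_sub_ge H hk hJc hψS hψ rfl hW0
  rw [← hW] at hen
  set G := H.U i - H.barJ i k - Jc / Real.sqrt M with hG
  have hWG : W * G ≤ H.energy ψ - H.energy Ω := by
    have h1 : W / W ^ (1 / (k : ℝ)) ≤ W / Real.sqrt M := by gcongr
    have h2 := mul_le_mul_of_nonneg_left h1 hJc0
    have h3 : W * G = (H.U i - H.barJ i k) * W - Jc * (W / Real.sqrt M) := by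
      rw [hG]; ring
    linarith
  have hX : 0 < H.U i - u - H.barJ i k := by linarith
  have hζ : 0 < H.zeta i u := div_pos hJ hX
  -- After clearing denominators this is exactly the second entry of the threshold; u is the margin
  -- that pays for both 1/√M corrections.
  have hconst : ∑ K ∈ Finset.Icc 1 k, H.barJ i K * monomialConst k M K ≤ H.zeta i u * G := by
    refine (sum_barJ_mul_monomialConst_le H (by omega) i M).trans ?_
    rw [div_le_iff₀ (by positivity)] at hth
    rw [BoseHubbard.zeta, hG, div_mul_eq_mul_div, le_div_iff₀ hX]
    have h1 : (Jc * H.barJ i k + 2 * H.barJcal * (H.U i - u - H.barJ i k)) / Real.sqrt M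
        ≤ u * H.barJ i k := by
      rw [div_le_iff₀ hs]; linarith
    have e1 : (H.barJ i k + 2 * H.barJcal / Real.sqrt M) * (H.U i - u - H.barJ i k)
        = H.barJ i k * (H.U i - u - H.barJ i k)
          + (2 * H.barJcal * (H.U i - u - H.barJ i k)) / Real.sqrt M := by ring
    have e2 : (Jc * H.barJ i k + 2 * H.barJcal * (H.U i - u - H.barJ i k)) / Real.sqrt M
        = H.barJ i k * (Jc / Real.sqrt M)
          + (2 * H.barJcal * (H.U i - u - H.barJ i k)) / Real.sqrt M := by ring
    rw [e1]
    rw [e2] at h1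
    linarith
  have hsum0 : 0 < ∑ K ∈ Finset.Icc 1 k, H.barJ i K * monomialConst k M K := by
    refine Finset.sum_pos' (fun K _ => mul_nonneg ?_ (monomialConst_nonneg k M K))
      ⟨k, by simp; omega, mul_pos hJ ?_⟩
    · exact Finset.sum_nonneg fun _ _ => Finset.sum_nonneg fun _ _ => norm_nonneg _
    · rw [monomialConst, if_pos rfl]; positivity
  have hG0 : 0 < G := pos_of_mul_pos_right (hsum0.trans_le hconst) hζ.le
  set z := H.zeta i u with hz
  -- The weight l = 1/(2ζ) maximizes l(1 - ζl), hence gives the best contraction factor.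
  have hl : 0 < (2 * z)⁻¹ := by positivity
  have hvar := (form_tail_le H (by omega) hS hΩ i y).trans
    (norm_form_tail_head_le H (by omega) hM hdom i y hl)
  rw [hsize] at hvar ⊢
  rw [inv_inv, ← he] at hvar
  set g' := formSize k M (tail i (y - k) Ω)
  have h1 : W * p * G ≤ z * G * ((2 * z)⁻¹ * (W * p) + 2 * z * g') := by
    have h2 := mul_le_mul_of_nonneg_right hWG h0.le
    have h3 := mul_le_mul_of_nonneg_right hconst
      (by positivity : 0 ≤ (2 * z)⁻¹ * (W * p) + 2 * z * g')
    linarith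
  have h4 : z * G * ((2 * z)⁻¹ * (W * p) + 2 * z * g')
      = (W * p / 2 + 2 * z ^ 2 * g') * G := by
    field_simp
  rw [h4] at h1
  have h5 := le_of_mul_le_mul_right h1 hG0
  linarith

/-- The base β is the smaller root of β = 2ζ(1 + β²), so 2ζ ≤ β. The constant 5 in the repulsive
condition yields 4ζ < 1. -/
theorem decayBase_bounds {i : Λ} (hJ : 0 < H.barJ i k) {u : ℝ}
    (hu' : u < H.U i - 5 * H.barJ i k) :
    2 * H.zeta i u ≤ H.decayBase i u ∧ 0 < H.decayBase i u ∧ H.decayBase i u < 1 := by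
  have hX : 0 < H.U i - u - H.barJ i k := by linarith
  have hζ : 0 < H.zeta i u := div_pos hJ hX
  have hζ4 : 4 * H.zeta i u < 1 := by
    rw [BoseHubbard.zeta, ← mul_div_assoc, div_lt_one hX]; linarith
  unfold BoseHubbard.decayBase
  set z := H.zeta i u
  have h1 : Real.sqrt (1 - 16 * z ^ 2) ≤ 1 - 8 * z ^ 2 := by
    refine Real.sqrt_le_iff.2 ⟨by nlinarith, ?_⟩
    nlinarith [sq_nonneg (z ^ 2)]
  have h2 : 1 - 4 * z < Real.sqrt (1 - 16 * z ^ 2) := by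
    refine Real.lt_sqrt_of_sq_lt ?_
    nlinarith
  have h3 : 2 * z ≤ (1 - Real.sqrt (1 - 16 * z ^ 2)) / (4 * z) := by
    rw [le_div_iff₀ (by positivity)]; nlinarith
  refine ⟨h3, by linarith, ?_⟩
  rw [div_lt_one (by positivity)]
  linarith

/-- A bounded function that contracts by `b ^ 2` over distance `d` decays exponentially. -/
theorem le_rpow_of_step {g : ℝ → ℝ} {b d y₀ C : ℝ} (hb : 0 < b) (hb1 : b < 1) (hd : 0 < d)
    (hC : 0 ≤ C) (hgC : ∀ y, g y ≤ C) (hstep : ∀ y, y₀ < y → g y ≤ b ^ 2 * g (y - d)) (y : ℝ) :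
    g y ≤ b ^ (2 * (y - y₀) / d) * C := by
  -- Induction on the number of blocks of length d above y₀; below y₀ the exponent is nonpositive
  -- and the bound is trivial.
  have key : ∀ (N : ℕ) (y : ℝ), y ≤ y₀ + N * d → g y ≤ b ^ (2 * (y - y₀) / d) * C := by
    have base : ∀ y, y ≤ y₀ → g y ≤ b ^ (2 * (y - y₀) / d) * C := by
      intro y hy
      have h1 : 1 ≤ b ^ (2 * (y - y₀) / d) :=
        Real.one_le_rpow_of_pos_of_le_one_of_nonpos hb hb1.le
          (div_nonpos_of_nonpos_of_nonneg (by linarith) hd.le)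
      have := hgC y
      nlinarith
    intro N
    induction N with
    | zero => intro y hy; exact base y (by simpa using hy)
    | succ N ih =>
      intro y hy
      rcases le_or_gt y y₀ with h | h
      · exact base y h
      · have h1 := ih (y - d) (by push_cast at hy; linarith)
        have e : b ^ 2 * b ^ (2 * (y - d - y₀) / d) = b ^ (2 * (y - y₀) / d) := by
          rw [← Real.rpow_two, ← Real.rpow_add hb]
          congr 1
          field_simp
          ring
        calc g y ≤ b ^ 2 * g (y - d) := hstep y h
          _ ≤ b ^ 2 * (b ^ (2 * (y - d - y₀) / d) * C) := by gcongr
          _ = _ := by rw [← mul_assoc, e]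
  obtain ⟨N, hN⟩ := exists_nat_ge ((y - y₀) / d)
  rw [div_le_iff₀ hd] at hN
  exact key N y (by linarith)

end Decay

end Boson

/-! ### The decay theorem -/

theorem mainTheorem1 {Λ : Type*} [Fintype Λ] [DecidableEq Λ] (k : ℕ) (hk : 3 ≤ k)
    (H : Boson.BoseHubbard Λ k) (hrep : H.Repulsive)
    (S : Set (Boson.FockSpace Λ)) (hS : H.IsAdmissibleSpace S)
    (Ω : Boson.FockSpace Λ) (hΩ : H.IsGroundState S Ω)
    (i : Λ) (hJ : 0 < H.barJ i k)
    (u : ℝ) (hu : 0 < u) (hu' : u < H.U i - 5 * H.barJ i k)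
    (Jc : ℝ)
    (hJc : ∀ Q : ℝ, 0 < Q →
      (((H.U i - H.barJ i k) * Q ^ ((k : ℝ) / 2) - Jc * Q ^ (((k : ℝ) - 1) / 2) : ℝ) : EReal)
        ≤ H.minEnergy S Q - (H.energy Ω : EReal)) :
    (0 < H.decayBase i u ∧ H.decayBase i u < 1) ∧
    ∀ x : ℝ, (Boson.expect (Boson.projGE i x) Ω).re
      ≤ H.decayBase i u ^ (2 * (x - H.threshold i u Jc) / (k : ℝ)) := by
  open Boson in
  obtain ⟨hζβ, hβ0, hβ1⟩ := decayBase_bounds H hJ hu'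
  refine ⟨⟨hβ0, hβ1⟩, fun x => ?_⟩
  rw [expect_projGE]
  have hk0 : (0 : ℝ) < k := by positivity
  have hUJ : 0 < H.U i - H.barJ i k := by linarith
  have hζ : 0 < H.zeta i u := div_pos hJ (by linarith)
  have hdom := formDomain_of_isState hΩ.2.1
  have hmassΩ := mass_of_isState hΩ.2.1
  set β := H.decayBase i u
  set T := H.threshold i u Jc with hT
  have hT0 : 0 ≤ T := le_max_of_le_right (sq_nonneg _)
  set W := ⨆ j, moment k j Ω with hW
  have hWs : W = ⨆ j, siteMoment k j (Ω : Config Λ → ℂ) := by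
    simp only [hW, moment_eq_siteMoment]
  have hWi : siteMoment k i (Ω : Config Λ → ℂ) ≤ W := by
    rw [hWs]; exact siteMoment_le_iSup k i _
  have hW0 : 0 ≤ W := (siteMoment_nonneg k i _).trans hWi
  -- The lower bound on ℰ_Q says nothing at Q = 0. If all moments vanish there are no bosons and the
  -- tails are empty for x > 0.
  rcases hW0.eq_or_lt with hW0 | hW0
  · rcases le_or_gt x 0 with hx | hx
    · have h1 : 1 ≤ β ^ (2 * (x - T) / (k : ℝ)) :=
        Real.one_le_rpow_of_pos_of_le_one_of_nonpos hβ0 hβ1.le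
          (div_nonpos_of_nonpos_of_nonneg (by linarith) hk0.le)
      have h2 := mass_mono hdom (norm_tail_le i x _)
      linarith
    · have h1 := mul_mass_tail_le hdom i zero_le_one (y := x) fun n hn => by
        have : (0 : ℝ) < n := hx.trans_le hn
        exact_mod_cast this
      have h2 := siteMoment_mono hdom (norm_tail_le i x _) i
      rw [Real.one_rpow, one_mul] at h1
      have h3 : mass (tail i x Ω) ≤ 0 := by linarith
      exact h3.trans (Real.rpow_nonneg hβ0.le _)
  -- Applied to Ω itself, whose excess energy is 0, the lower bound becomes an a priori bound on its
  -- moments and forces 𝒥̌ ≥ 0.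
  have hen := energy_sub_ge H hk hJc hΩ.1 hΩ.2.1 rfl hW0
  rw [← hW, sub_self] at hen
  set r := W ^ (1 / (k : ℝ)) with hr
  have hr0 : 0 < r := Real.rpow_pos_of_pos hW0 _
  have hrJ : (H.U i - H.barJ i k) * r ≤ Jc := by
    have e : (H.U i - H.barJ i k) * W - Jc * (W / r)
        = W / r * ((H.U i - H.barJ i k) * r - Jc) := by
      field_simp
    rw [e] at hen
    have := nonpos_of_mul_nonpos_right hen (by positivity)
    linarith
  have hJc0 : 0 ≤ Jc := le_trans (by positivity) hrJ
  have hrT : r ^ 2 ≤ T := by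
    have h1 : r ≤ Jc / (H.U i - H.barJ i k) := by
      rw [le_div_iff₀ hUJ]; linarith
    have h2 : r ^ 2 ≤ (Jc / (H.U i - H.barJ i k)) ^ 2 := by gcongr
    have h3 : (1 : ℝ) ≤ 2 ^ (2 / (k : ℝ)) := Real.one_le_rpow (by norm_num) (by positivity)
    have h4 : 2 ^ (2 / (k : ℝ)) * (Jc / (H.U i - H.barJ i k)) ^ 2 ≤ T := le_max_left _ _
    nlinarith [sq_nonneg (Jc / (H.U i - H.barJ i k))]
  -- The monomial estimates need M ≥ 1, while the threshold T may be smaller.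
  set M := max T 1 with hM
  have hM1 : 1 ≤ M := le_max_right _ _
  have hM0 : 0 ≤ M := by linarith
  have hTM : T ≤ M := le_max_left _ _
  have hWM : W ≤ M ^ ((k : ℝ) / 2) := by
    have e : (r ^ 2) ^ ((k : ℝ) / 2) = W := by
      rw [← Real.rpow_two, ← Real.rpow_mul hr0.le, hr, ← Real.rpow_mul hW0.le]
      have : 1 / (k : ℝ) * (2 * (k / 2)) = 1 := by field_simp
      rw [this, Real.rpow_one]
    rw [← e]
    exact Real.rpow_le_rpow (by positivity) (hrT.trans hTM) (by positivity)
  have hth : (Jc * H.barJ i k + 2 * H.barJcal * (H.U i - u - H.barJ i k)) / (u * H.barJ i k)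
      ≤ Real.sqrt M :=
    Real.le_sqrt_of_sq_le ((le_max_right _ _).trans hTM)
  have hMpos : 0 < M ^ ((k : ℝ) / 2) := by positivity
  have hsize : ∀ y, formSize k M (tail i y Ω) ≤ M ^ ((k : ℝ) / 2) := fun y => by
    refine (formSize_mono hM0 hdom (norm_tail_le i y _)).trans (max_le ?_ ?_)
    · rw [← hWs]; exact hWM
    · rw [hmassΩ, mul_one]
  -- For T < 1 the contraction already starts at 0, since a positive occupation is at least 1 = M;
  -- raising T to M costs nothing.
  obtain ⟨y₀, hy₀T, hy₀⟩ : ∃ y₀ ≤ T, ∀ y : ℝ, y₀ < y → ∀ n : ℕ, y ≤ n → M ≤ n := by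
    rcases le_or_gt 1 T with h | h
    · refine ⟨T, le_rfl, fun y hy n hn => ?_⟩
      rw [hM, max_eq_left h]; linarith
    · refine ⟨0, hT0, fun y hy n hn => ?_⟩
      rw [hM, max_eq_right h.le]
      have : (0 : ℝ) < n := hy.trans_le hn
      exact_mod_cast this
  have hdecay := le_rpow_of_step (g := fun y => formSize k M (tail i y Ω)) hβ0 hβ1 hk0 hMpos.le
    hsize (y₀ := y₀) (fun y hy => by
      refine (formSize_tail_le H hk hS hΩ hJ hu hu' hJc0 hJc hM1 hth (hy₀ y hy)).trans ?_
      have := formSize_nonneg k hM0 (tail i (y - k) Ω)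
      gcongr) x
  have h1 : M ^ ((k : ℝ) / 2) * mass (tail i x Ω) ≤ formSize k M (tail i x Ω) := le_max_right _ _
  have h2 : mass (tail i x Ω) ≤ β ^ (2 * (x - y₀) / (k : ℝ)) := by
    refine le_of_mul_le_mul_left ?_ hMpos
    linarith
  refine h2.trans (Real.rpow_le_rpow_of_exponent_ge hβ0 hβ1.le ?_)
  gcongr
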